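/- Let $G$ be a finite group and let $n \ge 0$. A projective $n$-complex $E=(P_*,\partial_*)$ over $\mathbb{Z}G$ is a chain complex $P_n \xrightarrow{\partial_n} P_{n-1} \to \cdots \xrightarrow{\partial_1} P_0$ of finitely generated projective left $\mathbb{Z}G$-modules together with a $\mathbb{Z}G$-homomorphism $\varepsilon : P_0 \to \mathbb{Z}$ (where $\mathbb{Z}$ has trivial $G$-action) such that the sequence $P_n \xrightarrow{\partial_n} \cdots \xrightarrow{\partial_1} P_0 \xrightarrow{\varepsilon} \mathbb{Z} \to 0$ is exact; no condition is imposed on the kernel of its first map ($\partial_n$ if $n \ge 1$, $\varepsilon$ if $n = 0$). Its stabilisation $E \oplus \mathbb{Z}G$ is the projective $n$-complex obtained by replacing $P_n$ by $P_n \oplus \mathbb{Z}G$ and the first map of this sequence by its extension by $0$ on $\mathbb{Z}G$. Write $E \simeq E'$ if there is a chain homotopy equivalence $\varphi : (P_*,\partial_*) \to (P'_*,\partial'_*)$ of $\mathbb{Z}G$-chain complexes and a $\mathbb{Z}G$-automorphism $\theta$ of $\mathbb{Z}$ with $\varepsilon' \circ \varphi_0 = \theta \circ \varepsilon$ (for $n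 \ge 1$ the automorphism $\theta$ exists automatically). Suppose that $n$ is even and that $E$, $E'$, $E_0$ are projective $n$-complexes over $\mathbb{Z}G$. If $E \simeq E_0 \oplus \mathbb{Z}G$ and $E \oplus \mathbb{Z}G \simeq E' \oplus \mathbb{Z}G$, then $E \simeq E'$. -/

import Mathlib

open CategoryTheory CategoryTheory.Limits

universe u

/-- The trivial `ℤG`-module `ℤ`: the underlying group is `ℤ` and every `g : G` acts as the
identity. -/
abbrev TrivialZ (G : Type u) [Group G] : Type :=
  (Representation.trivial ℤ G ℤ).asModule

/-- The chain complex consisting of `ℤG` concentrated in degree `n`. -/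
noncomputable abbrev groupRingInDegree (G : Type u) [Group G] (n : ℕ) :
    ChainComplex (ModuleCat.{u} (MonoidAlgebra ℤ G)) ℕ :=
  (HomologicalComplex.single (ModuleCat.{u} (MonoidAlgebra ℤ G)) (ComplexShape.down ℕ) n).obj
    (ModuleCat.of (MonoidAlgebra ℤ G) (MonoidAlgebra ℤ G))

/-- A projective `n`-complex over `ℤG`: a chain complex `Pₙ ⟶ ⋯ ⟶ P₀` of finitely generated
projective (left) `ℤG`-modules with an augmentation `ε : P₀ → ℤ` onto the trivial module, such that
`Pₙ ⟶ ⋯ ⟶ P₀ ⟶ ℤ ⟶ 0` is exact (no condition is imposed on the kernel of the first map of this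
sequence, that is on `Pₙ ⟶ Pₙ₋₁` if `n ≥ 1`, on `ε` if `n = 0`). -/
structure ProjectiveComplex (G : Type u) [Group G] (n : ℕ) where
  /-- the un-augmented chain complex, extended by zero above degree `n` -/
  cx : ChainComplex (ModuleCat.{u} (MonoidAlgebra ℤ G)) ℕ
  /-- the augmentation `P₀ → ℤ` -/
  aug : cx.X 0 →ₗ[MonoidAlgebra ℤ G] TrivialZ G
  projective : ∀ i, Module.Projective (MonoidAlgebra ℤ G) (cx.X i)
  finite : ∀ i, Module.Finite (MonoidAlgebra ℤ G) (cx.X i)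
  isZero_of_lt : ∀ i, n < i → IsZero (cx.X i)
  exact_d : ∀ i, i + 1 < n →
    Function.Exact (cx.d (i + 2) (i + 1)).hom (cx.d (i + 1) i).hom
  exact_aug : 0 < n → Function.Exact (cx.d 1 0).hom aug
  aug_surjective : Function.Surjective aug

namespace ProjectiveComplex

variable {G : Type u} [Group G] {n : ℕ}

/-- Chain homotopy equivalence of projective `n`-complexes: a chain homotopy equivalence `φ` of the
un-augmented complexes which extends to the augmentations, i.e. for which there is an automorphism
`θ` of `ℤ` with `ε' ∘ φ₀ = θ ∘ ε`.  For `n ≥ 1` one has `H₀ ≅ ℤ` through the augmentations, so that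
such a `θ` exists automatically. -/
def Equivalent (E E' : ProjectiveComplex G n) : Prop :=
  ∃ (φ : HomotopyEquiv E.cx E'.cx) (θ : TrivialZ G ≃ₗ[MonoidAlgebra ℤ G] TrivialZ G),
    ∀ x : E.cx.X 0, E'.aug ((φ.hom.f 0).hom x) = θ (E.aug x)

section biprod

variable (C D : ChainComplex (ModuleCat.{u} (MonoidAlgebra ℤ G)) ℕ)

/-- A direct sum of chain complexes is the degreewise direct sum. -/
noncomputable def biprodXEquiv (i : ℕ) :
    (C ⊞ D).X i ≃ₗ[MonoidAlgebra ℤ G] C.X i × D.X i where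
  toLinearMap := LinearMap.prod ((biprod.fst : C ⊞ D ⟶ C).f i).hom
    ((biprod.snd : C ⊞ D ⟶ D).f i).hom
  invFun z := ((biprod.inl : C ⟶ C ⊞ D).f i).hom z.1 + ((biprod.inr : D ⟶ C ⊞ D).f i).hom z.2
  left_inv z := by
    have h := congrArg (fun f : C ⊞ D ⟶ C ⊞ D => (f.f i).hom z) (biprod.total (X := C) (Y := D))
    exact h
  right_inv z := by
    have h1 := congrArg (fun f : C ⟶ C => (f.f i).hom z.1) (biprod.inl_fst (X := C) (Y := D))
    have h2 := congrArg (fun f : C ⟶ D => (f.f i).hom z.1) (biprod.inl_snd (X := C) (Y := D))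
    have h3 := congrArg (fun f : D ⟶ C => (f.f i).hom z.2) (biprod.inr_fst (X := C) (Y := D))
    have h4 := congrArg (fun f : D ⟶ D => (f.f i).hom z.2) (biprod.inr_snd (X := C) (Y := D))
    refine Prod.ext ?_ ?_
    · refine (map_add ((biprod.fst : C ⊞ D ⟶ C).f i).hom _ _).trans ?_
      exact (congrArg₂ (· + ·) h1 h3).trans (add_zero _)
    · refine (map_add ((biprod.snd : C ⊞ D ⟶ D).f i).hom _ _).trans ?_
      exact (congrArg₂ (· + ·) h2 h4).trans (zero_add _)

theorem biprodXEquiv_d (i j : ℕ) (z : (C ⊞ D).X i) :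
    biprodXEquiv C D j (((C ⊞ D).d i j).hom z) =
      ((C.d i j).hom (biprodXEquiv C D i z).1, (D.d i j).hom (biprodXEquiv C D i z).2) := by
  have h1 := congrArg (fun f => f.hom z) ((biprod.fst : C ⊞ D ⟶ C).comm i j)
  have h2 := congrArg (fun f => f.hom z) ((biprod.snd : C ⊞ D ⟶ D).comm i j)
  exact Prod.ext h1.symm h2.symm

end biprod

theorem subsingleton_groupRingInDegree (i : ℕ) (h : i ≠ n) :
    Subsingleton ((groupRingInDegree G n).X i) :=
  ModuleCat.subsingleton_of_isZero (HomologicalComplex.isZero_single_obj_X _ _ _ _ h)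

theorem free_finite_groupRingInDegree (i : ℕ) :
    Module.Free (MonoidAlgebra ℤ G) ((groupRingInDegree G n).X i) ∧
      Module.Finite (MonoidAlgebra ℤ G) ((groupRingInDegree G n).X i) := by
  by_cases h : i = n
  · subst h
    have e := (HomologicalComplex.singleObjXSelf (ComplexShape.down ℕ) i
      (ModuleCat.of (MonoidAlgebra ℤ G) (MonoidAlgebra ℤ G))).toLinearEquiv
    exact ⟨Module.Free.of_equiv e.symm, Module.Finite.equiv e.symm⟩
  · have := subsingleton_groupRingInDegree (G := G) i h
    exact ⟨inferInstance, inferInstance⟩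

/-- The stabilisation `E ⊕ ℤG = (Pₙ ⊕ ℤG ⟶ Pₙ₋₁ ⟶ ⋯ ⟶ P₀)`, with first map `(∂ₙ, 0)`: the direct
sum of the complex with `ℤG` concentrated in degree `n`, with augmentation `(ε, 0)`. -/
noncomputable def stabilize (E : ProjectiveComplex G n) : ProjectiveComplex G n where
  cx := E.cx ⊞ groupRingInDegree G n
  aug := E.aug ∘ₗ ((biprod.fst : E.cx ⊞ groupRingInDegree G n ⟶ E.cx).f 0).hom
  projective i := by
    have := E.projective i
    have := (free_finite_groupRingInDegree (G := G) (n := n) i).1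
    exact Module.Projective.of_equiv (biprodXEquiv E.cx (groupRingInDegree G n) i).symm
  finite i := by
    have := E.finite i
    have := (free_finite_groupRingInDegree (G := G) (n := n) i).2
    exact Module.Finite.equiv (biprodXEquiv E.cx (groupRingInDegree G n) i).symm
  isZero_of_lt i hi := by
    have := ModuleCat.subsingleton_of_isZero (E.isZero_of_lt i hi)
    have := subsingleton_groupRingInDegree (G := G) i hi.ne'
    have := (biprodXEquiv E.cx (groupRingInDegree G n) i).toEquiv.subsingleton
    exact ModuleCat.isZero_of_subsingleton _
  exact_d i hi := by
    have := subsingleton_groupRingInDegree (G := G) (i + 1) hi.ne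
    intro z
    rw [← (biprodXEquiv E.cx (groupRingInDegree G n) i).map_eq_zero_iff, biprodXEquiv_d,
      Prod.mk_eq_zero]
    constructor
    · rintro ⟨hz, -⟩
      obtain ⟨w, hw⟩ := (E.exact_d i hi _).1 hz
      refine ⟨(biprodXEquiv E.cx (groupRingInDegree G n) (i + 2)).symm (w, 0), ?_⟩
      apply (biprodXEquiv E.cx (groupRingInDegree G n) (i + 1)).injective
      rw [biprodXEquiv_d, LinearEquiv.apply_symm_apply]
      exact Prod.ext hw (Subsingleton.elim _ _)
    · rintro ⟨w, rfl⟩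
      rw [biprodXEquiv_d]
      exact ⟨(E.exact_d i hi _).2 ⟨_, rfl⟩, by simp⟩
  exact_aug hn := by
    have := subsingleton_groupRingInDegree (G := G) 0 hn.ne
    intro z
    refine (E.exact_aug hn (biprodXEquiv E.cx (groupRingInDegree G n) 0 z).1).trans ?_
    constructor
    · rintro ⟨w, hw⟩
      refine ⟨(biprodXEquiv E.cx (groupRingInDegree G n) 1).symm (w, 0), ?_⟩
      apply (biprodXEquiv E.cx (groupRingInDegree G n) 0).injective
      rw [biprodXEquiv_d, LinearEquiv.apply_symm_apply]
      exact Prod.ext hw (Subsingleton.elim _ _)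
    · rintro ⟨w, rfl⟩
      rw [biprodXEquiv_d]
      exact ⟨_, rfl⟩
  aug_surjective := by
    intro a
    obtain ⟨x, hx⟩ := E.aug_surjective a
    refine ⟨(biprodXEquiv E.cx (groupRingInDegree G n) 0).symm (x, 0), ?_⟩
    have h : (biprodXEquiv E.cx (groupRingInDegree G n) 0
      ((biprodXEquiv E.cx (groupRingInDegree G n) 0).symm (x, 0))).1 = x := by simp
    exact (congrArg E.aug h).trans hx

end ProjectiveComplex

/-! Stabilising `h₀` reduces the claim to cancelling one copy of ℤG from E' ⊕ ℤG ≃ F, where F = E₀ ⊕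
ℤG ⊕ ℤG. Let P be the top module of E₀ and J ⊆ P its top cycles. The equivalence sends the generator
of the last ℤG of E' ⊕ ℤG to a top cycle v of F, and the homotopy inverse shows that v is
unimodular. An automorphism of P ⊕ ℤG ⊕ ℤG that is the identity modulo J ⊕ ℤG ⊕ ℤG extends by the
identity in lower degrees to an automorphism of F. If one of these moves v to the last basis vector,
the composite equivalence fixes the summand ℤG, which can then be cancelled
(`HomotopyEquiv.cancelRight`).

So transvections must act transitively on the unimodular elements of J ⊕ ℤG ⊕ ℤG
(`isConjugateModulo_of_isUnimodular`). Parity enters here. Characters of finitely generated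
projectives vanish off the identity (`groupRingTrace_eq_zero_of_projective`), so for even n the
character of J is -1 there. Rationally J then contains the augmentation ideal as a summand
(`exists_apply_eq_smul_card_sub_norm`), hence the complement of the trivial representation. On the
trivial part the Euclidean algorithm in ℤ on augmentations does the work of J. On the complement J
supplies one further free coordinate, and stable range one of finite rings
(`exists_isUnit_add_mul_of_finite`), applied to reductions of ℤG, removes a coordinate
(`exists_unimodular_add_smul`). -/

/-! ### Traces of idempotents and of maps of lattices -/

open Polynomial in
/-- Over a commutative ring without nontrivial idempotents, the trace of an idempotent matrix is a
natural number. -/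
theorem Matrix.exists_trace_eq_natCast_of_isIdempotentElem {R ι : Type*} [CommRing R] [Fintype ι]
    [DecidableEq ι] (hR : ∀ x : R, x * x = x → x = 0 ∨ x = 1) (A : Matrix ι ι R)
    (hA : A * A = A) : ∃ r : ℕ, A.trace = r := by
  cases subsingleton_or_nontrivial R
  · exact ⟨0, Subsingleton.elim _ _⟩
  set f : R[X] := (det (1 + (X : R[X]) • A.map C)).comp (X - 1) with hf
  have key : ∀ (S : Type _) [CommRing S] [Algebra R S] (s : S),
      aeval s f = det (1 + (s - 1) • A.map (algebraMap R S)) := by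
    intro S _ _ s
    rw [hf, aeval_comp]
    simp only [map_sub, aeval_X, map_one]
    rw [AlgHom.map_det]
    congr 1
    ext i j
    by_cases hij : i = j <;> simp [hij] <;> ring
  -- Since A² = A, s ↦ 1 + (s - 1)A is multiplicative, and hence so is its determinant f.
  have hmul : ∀ (S : Type _) [CommRing S] [Algebra R S] (s t : S),
      aeval s f * aeval t f = aeval (s * t) f := by
    intro S _ _ s t
    rw [key, key, key, ← det_mul]
    congr 1
    have h2 : A.map (algebraMap R S) * A.map (algebraMap R S) = A.map (algebraMap R S) := by
      rw [← Matrix.map_mul, hA]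
    rw [add_mul, mul_add, mul_add, one_mul, one_mul, mul_one, smul_mul_smul_comm, h2,
      add_assoc, ← add_smul, ← add_smul]
    congr 2
    ring
  have h1 : aeval (C X : R[X][X]) f = C f := by
    have : aeval (C X : R[X][X]) = (CAlgHom : R[X] →ₐ[R] R[X][X]) := by ext; simp
    rw [this]; rfl
  have h2 : aeval (X : R[X][X]) f = f.map C := by
    have : aeval (X : R[X][X]) = mapAlgHom (CAlgHom : R →ₐ[R] R[X]) := by ext; simp
    rw [this]; rfl
  -- Compare coefficients in f(X) f(Y) = f(XY): the coefficients of f are orthogonal idempotents, so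
  -- one that equals 1 forces f to be a monomial.
  have hcoeff : ∀ i, f * C (f.coeff i) = C (f.coeff i) * X ^ i := by
    intro i
    have h := congrArg (fun p : R[X][X] => p.coeff i) (hmul R[X][X] (C X) X)
    simp only [h1, h2, coeff_C_mul, coeff_map] at h
    rw [h, aeval_eq_sum_range' (Nat.lt_succ_of_le (le_max_left f.natDegree i)), finsetSum_coeff,
      Finset.sum_eq_single i]
    · rw [coeff_smul, mul_pow, ← C_pow, coeff_C_mul, coeff_X_pow_self, mul_one, smul_eq_C_mul]
    · intro j _ hj
      rw [coeff_smul, mul_pow, ← C_pow, coeff_C_mul, coeff_X_pow, if_neg hj.symm, mul_zero,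
        smul_zero]
    · intro hi
      simp at hi
  have hone : f.eval 1 = 1 := by
    have := key R 1
    simpa [coe_aeval_eq_eval] using this
  obtain ⟨i, hi⟩ : ∃ i, f.coeff i ≠ 0 := by
    by_contra! h0
    have : f = 0 := by ext i; simpa using h0 i
    simp [this] at hone
  have hi1 : f.coeff i = 1 := by
    have := congrArg (fun p => p.coeff i) (hcoeff i)
    simp only [coeff_mul_C, coeff_C_mul, coeff_X_pow_self, mul_one] at this
    exact (hR _ this).resolve_left hi
  have hfi : f = X ^ i := by simpa [hi1] using hcoeff i
  refine ⟨i, ?_⟩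
  -- The derivative of det(1 + (X - 1)A) at 1 is the trace, and that of X ^ i is i.
  have hd := congrArg (fun p => (derivative p).eval 1) hfi
  simpa [hf, derivative_comp, eval_comp, derivative_det_one_add_X_smul, derivative_X_pow] using hd

/-- Transitivity of the trace for endomorphisms of a free module. -/
theorem LinearMap.trace_int_eq_trace_trace {R F : Type*} [CommRing R] [Module.Free ℤ R]
    [Module.Finite ℤ R] [AddCommGroup F] [Module R F] [Module.Free R F] [Module.Finite R F]
    (T : F →ₗ[R] F) :
    LinearMap.trace ℤ F (T.restrictScalars ℤ) = Algebra.trace ℤ R (LinearMap.trace R F T) := by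
  classical
  cases subsingleton_or_nontrivial R
  · have : Subsingleton F := Module.subsingleton R F
    simp [Subsingleton.elim T 0, LinearMap.restrictScalars_zero]
  let b := Module.Free.chooseBasis ℤ R
  let c := Module.Free.chooseBasis R F
  rw [LinearMap.trace_eq_matrix_trace ℤ (b.smulTower c), LinearMap.trace_eq_matrix_trace R c,
    Matrix.trace, Matrix.trace, map_sum, Fintype.sum_prod_type_right]
  refine Finset.sum_congr rfl fun j _ => ?_
  rw [Algebra.trace_eq_matrix_trace b, Matrix.trace]
  refine Finset.sum_congr rfl fun i _ => ?_
  simp [Matrix.diag, LinearMap.toMatrix_apply, Algebra.leftMulMatrix_eq_repr_mul,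
    Module.Basis.smulTower_repr, mul_comm]

/-- The trace of an endomorphism `T` with `T² = mT` is `m` times the rank of its range. -/
theorem LinearMap.trace_eq_mul_finrank_range {W : Type*} [AddCommGroup W] [Module.Finite ℤ W]
    [Module.Free ℤ W] (T : W →ₗ[ℤ] W) (m : ℤ) (hT : ∀ x, T (T x) = m • T x) :
    LinearMap.trace ℤ W T = m * Module.finrank ℤ (LinearMap.range T) := by
  have h1 : T = (LinearMap.range T).subtype ∘ₗ T.rangeRestrict := rfl
  have h2 : T.rangeRestrict ∘ₗ (LinearMap.range T).subtype = m • LinearMap.id := by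
    ext ⟨_, x, rfl⟩
    simpa using hT x
  conv_lhs => rw [h1]
  rw [LinearMap.trace_comp_comm', h2, map_smul, LinearMap.trace_id, smul_eq_mul]

/-- The trace is additive in short exact sequences of lattices. -/
theorem LinearMap.trace_eq_add_of_exact {K M L : Type*} [AddCommGroup K] [AddCommGroup M]
    [AddCommGroup L] [Module.Finite ℤ K] [Module.Free ℤ K] [Module.Finite ℤ M] [Module.Free ℤ M]
    [Module.Finite ℤ L] [Module.Free ℤ L] (ι : K →ₗ[ℤ] M) (f : M →ₗ[ℤ] L)
    (hι : Function.Injective ι) (hex : Function.Exact ι f) (hf : Function.Surjective f)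
    (U : K →ₗ[ℤ] K) (T : M →ₗ[ℤ] M) (S : L →ₗ[ℤ] L) (hU : ∀ x, ι (U x) = T (ι x))
    (hS : ∀ x, f (T x) = S (f x)) :
    LinearMap.trace ℤ M T = LinearMap.trace ℤ K U + LinearMap.trace ℤ L S := by
  obtain ⟨s, hs⟩ := Module.projective_lifting_property f LinearMap.id hf
  have hs' : ∀ y, f (s y) = y := fun y => by simpa using congrArg (fun k => k y) hs
  let p : M →ₗ[ℤ] K := (LinearEquiv.ofInjective ι hι).symm.toLinearMap ∘ₗ
    LinearMap.codRestrict (LinearMap.range ι) (LinearMap.id - s ∘ₗ f) fun x =>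
      (hex _).1 (by simp [hs'])
  have hp : ∀ x, ι (p x) = x - s (f x) := fun x =>
    congrArg Subtype.val ((LinearEquiv.ofInjective ι hι).apply_symm_apply _)
  have h1 : T = (T ∘ₗ ι) ∘ₗ p + (T ∘ₗ s) ∘ₗ f := by
    ext x; simp [hp]
  have h2 : p ∘ₗ T ∘ₗ ι = U := by
    ext x
    apply hι
    simp [hp, ← hU, hex.apply_apply_eq_zero]
  have h3 : f ∘ₗ T ∘ₗ s = S := by
    ext y
    simp [hS, hs']
  conv_lhs => rw [h1]
  rw [map_add, LinearMap.trace_comp_comm' p (T ∘ₗ ι), LinearMap.trace_comp_comm' f (T ∘ₗ s), h2, h3]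

/-! ### Characters of modules over the integral group ring -/

/-- The `ℤ`-trace of the action of an element of the group ring. -/
noncomputable def groupRingTrace (G M : Type*) [Group G] [AddCommGroup M]
    [Module (MonoidAlgebra ℤ G) M] : MonoidAlgebra ℤ G →+ ℤ :=
  (LinearMap.trace ℤ M).toAddMonoidHom.comp
    (Module.toModuleEnd ℤ M : MonoidAlgebra ℤ G →+* Module.End ℤ M).toAddMonoidHom

theorem groupRingTrace_apply {G M : Type*} [Group G] [AddCommGroup M]
    [Module (MonoidAlgebra ℤ G) M] (x : MonoidAlgebra ℤ G) :
    groupRingTrace G M x =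
      LinearMap.trace ℤ M (Module.toModuleEnd ℤ M x : Module.End ℤ M) := rfl

theorem groupRingTrace_single {G M : Type*} [Group G] [AddCommGroup M]
    [Module (MonoidAlgebra ℤ G) M] (g : G) (k : ℤ) :
    groupRingTrace G M (MonoidAlgebra.single g k) =
      k * groupRingTrace G M (MonoidAlgebra.single g 1) := by
  rw [← smul_eq_mul, ← map_zsmul, ← mul_one k, ← smul_eq_mul, ← MonoidAlgebra.smul_single]
  simp

/-- The trace of the regular representation. -/
theorem groupRingTrace_self {G : Type*} [Group G] [Finite G] (x : MonoidAlgebra ℤ G) :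
    groupRingTrace G (MonoidAlgebra ℤ G) x = Nat.card G * x.coeff 1 := by
  classical
  have := Fintype.ofFinite G
  induction x using MonoidAlgebra.induction_linear with
  | zero => simp
  | add x y hx hy => rw [map_add, hx, hy, MonoidAlgebra.coeff_add, Finsupp.add_apply, mul_add]
  | single g k =>
    rw [groupRingTrace_single, groupRingTrace_apply,
      LinearMap.trace_eq_matrix_trace ℤ (MonoidAlgebra.basis G ℤ), Matrix.trace]
    have : ∀ h : G, Matrix.diag (LinearMap.toMatrix (MonoidAlgebra.basis G ℤ)
        (MonoidAlgebra.basis G ℤ) (Module.toModuleEnd ℤ (MonoidAlgebra ℤ G)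
          (MonoidAlgebra.single g (1 : ℤ)))) h = if g = 1 then 1 else 0 := by
      intro h
      simp [Matrix.diag, LinearMap.toMatrix_apply, MonoidAlgebra.basis,
        MonoidAlgebra.single_mul_single, Finsupp.single_apply]
    simp only [this]
    by_cases hg : g = 1 <;> simp [hg, mul_comm]

/-- For an element with `x² = mx`, the trace is `m` times the rank of its image. -/
theorem groupRingTrace_eq_mul_finrank {G M : Type*} [Group G] [AddCommGroup M]
    [Module (MonoidAlgebra ℤ G) M] [Module.Finite ℤ M] [Module.Free ℤ M]
    (x : MonoidAlgebra ℤ G) (m : ℤ) (hx : x * x = m • x) :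
    groupRingTrace G M x = m * Module.finrank ℤ
      (LinearMap.range (Module.toModuleEnd ℤ M x : Module.End ℤ M)) := by
  refine LinearMap.trace_eq_mul_finrank_range _ m fun y => ?_
  change x • x • y = m • x • y
  rw [← mul_smul, hx, smul_assoc]

/-- The integral group ring of a finite group has no nontrivial idempotents. -/
theorem MonoidAlgebra.eq_zero_or_one_of_mul_self {G : Type*} [Group G] [Finite G]
    (x : MonoidAlgebra ℤ G) (hx : x * x = x) : x = 0 ∨ x = 1 := by
  -- The rank of the image of an idempotent y is its trace |G| · y₁. For x and 1 - x the integers y₁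
  -- are nonnegative with sum 1, so one of the two images is zero.
  have key : ∀ y : MonoidAlgebra ℤ G, y * y = y → 0 ≤ y.coeff 1 ∧ (y.coeff 1 = 0 → y = 0) := by
    intro y hy
    have h := groupRingTrace_eq_mul_finrank (M := MonoidAlgebra ℤ G) y 1 (by simpa using hy)
    rw [groupRingTrace_self, one_mul] at h
    have hc : (0 : ℤ) < Nat.card G := by exact_mod_cast Nat.card_pos
    refine ⟨?_, fun h0 => ?_⟩
    · by_contra! hneg
      have := mul_neg_of_pos_of_neg hc hneg
      omega
    · rw [h0, mul_zero] at h
      have h1 := Submodule.finrank_eq_zero.1 (Nat.cast_eq_zero.1 h.symm)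
      have h2 : y • (1 : MonoidAlgebra ℤ G) ∈ LinearMap.range
        (Module.toModuleEnd ℤ (MonoidAlgebra ℤ G) y : Module.End ℤ _) := ⟨1, rfl⟩
      rw [h1] at h2
      simpa using h2
  obtain ⟨h1, h2⟩ := key x hx
  obtain ⟨h3, h4⟩ := key (1 - x) (by noncomm_ring [hx])
  simp only [MonoidAlgebra.coeff_sub, Finsupp.sub_apply, MonoidAlgebra.coeff_one_one] at h3 h4
  have : x.coeff 1 = 0 ∨ x.coeff 1 = 1 := by omega
  rcases this with h | h
  · exact .inl (h2 h)
  · exact .inr (sub_eq_zero.1 (h4 (by omega))).symm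

/-- The group ring is free over the group ring of a subgroup. -/
theorem MonoidAlgebra.free_finite_of_injective {G C : Type*} [Group G] [Finite G] [Group C]
    (f : C →* G) (hf : Function.Injective f) :
    letI : Module (MonoidAlgebra ℤ C) (MonoidAlgebra ℤ G) :=
      Module.compHom _ (MonoidAlgebra.mapDomainRingHom ℤ f)
    Module.Free (MonoidAlgebra ℤ C) (MonoidAlgebra ℤ G) ∧
      Module.Finite (MonoidAlgebra ℤ C) (MonoidAlgebra ℤ G) := by
  let _ : Module (MonoidAlgebra ℤ C) (MonoidAlgebra ℤ G) :=
    Module.compHom _ (MonoidAlgebra.mapDomainRingHom ℤ f)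
  have hsmul : ∀ (r : MonoidAlgebra ℤ C) (x : MonoidAlgebra ℤ G),
    r • x = MonoidAlgebra.mapDomainRingHom ℤ f r * x := fun _ _ => rfl
  obtain ⟨T, hT, -⟩ := f.range.exists_isComplement_right 1
  let e : C × T ≃ G := Equiv.ofBijective (fun p => f p.1 * p.2) <|
    (show Function.Bijective fun x : f.range × T => x.1.1 * x.2.1 from hT).comp
      ((MonoidHom.ofInjective hf).toEquiv.prodCongr (Equiv.refl T)).bijective
  have he : ∀ c t, e (c, t) = f c * t := fun _ _ => rfl
  let Φ : (T →₀ MonoidAlgebra ℤ C) →ₗ[MonoidAlgebra ℤ C] MonoidAlgebra ℤ G :=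
    Finsupp.linearCombination _ fun t : T => MonoidAlgebra.single (t : G) (1 : ℤ)
  let Ψ : MonoidAlgebra ℤ G →+ (T →₀ MonoidAlgebra ℤ C) :=
    (Finsupp.liftAddHom fun g => (Finsupp.singleAddHom (e.symm g).2).comp
      (MonoidAlgebra.singleAddHom (e.symm g).1)).comp MonoidAlgebra.coeffAddEquiv.toAddMonoidHom
  have hΨ : ∀ g k, Ψ (MonoidAlgebra.single g k) =
      Finsupp.single (e.symm g).2 (MonoidAlgebra.single (e.symm g).1 k) := by
    intro g k
    simp [Ψ]
  have hΦ : ∀ t c k, Φ (Finsupp.single t (MonoidAlgebra.single c k)) =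
      MonoidAlgebra.single (e (c, t)) k := by
    intro t c k
    simp [Φ, hsmul, he, MonoidAlgebra.single_mul_single]
  have h1 : Function.LeftInverse Ψ Φ := by
    intro x
    induction x using Finsupp.induction_linear with
    | zero => simp
    | add x y hx hy => rw [map_add, map_add, hx, hy]
    | single t r =>
      induction r using MonoidAlgebra.induction_linear with
      | zero => simp
      | add x y hx hy => rw [Finsupp.single_add, map_add, map_add, hx, hy]
      | single c k => rw [hΦ, hΨ]; simp
  have h2 : Function.RightInverse Ψ Φ := by
    intro x
    induction x using MonoidAlgebra.induction_linear with
    | zero => simp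
    | add x y hx hy => rw [map_add, map_add, hx, hy]
    | single g k => rw [hΨ, hΦ]; simp
  let E := LinearEquiv.ofBijective Φ ⟨h1.injective, h2.surjective⟩
  exact ⟨Module.Free.of_equiv E, Module.Finite.equiv E⟩

/-- The character of a finitely generated projective module over the integral group ring of a
finite group vanishes away from the identity (Swan). -/
theorem groupRingTrace_eq_zero_of_projective {G P : Type*} [Group G] [Finite G] [AddCommGroup P]
    [Module (MonoidAlgebra ℤ G) P] [Module.Finite (MonoidAlgebra ℤ G) P]
    [Module.Projective (MonoidAlgebra ℤ G) P] [Module.Finite ℤ P] [Module.Free ℤ P]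
    (g : G) (hg : g ≠ 1) : groupRingTrace G P (MonoidAlgebra.single g 1) = 0 := by
  classical
  obtain ⟨N, q, i, -, -, hqi⟩ :=
    Module.Finite.exists_comp_eq_id_of_projective (MonoidAlgebra ℤ G) P
  have hqi' : ∀ x, q (i x) = x := fun x => by simpa using congrArg (fun k => k x) hqi
  -- Restriction to the cyclic group generated by g makes the coefficient ring R commutative, so
  -- that the projector e onto P has a trace in R, which is a natural number r. Then g has trace r ·
  -- tr(γ) on P, and γ has trace 0 on R.
  let _ : CommGroup (Subgroup.zpowers g) :=
    { (inferInstance : Group (Subgroup.zpowers g)) with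
      mul_comm := fun a b => by
        obtain ⟨_, k, rfl⟩ := a
        obtain ⟨_, l, rfl⟩ := b
        exact Subtype.ext (by simp [← zpow_add, add_comm]) }
  let f : Subgroup.zpowers g →* G := (Subgroup.zpowers g).subtype
  let R := MonoidAlgebra ℤ (Subgroup.zpowers g)
  let _ : Module R (MonoidAlgebra ℤ G) := Module.compHom _ (MonoidAlgebra.mapDomainRingHom ℤ f)
  obtain ⟨hfree, hfin⟩ := MonoidAlgebra.free_finite_of_injective f Subtype.val_injective
  have : Module.Free R (MonoidAlgebra ℤ G) := hfree
  have : Module.Finite R (MonoidAlgebra ℤ G) := hfin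
  let F := Fin N → MonoidAlgebra ℤ G
  have hsmul : ∀ (r : R) (x : F), r • x = MonoidAlgebra.mapDomainRingHom ℤ f r • x :=
    fun _ _ => rfl
  let e : F →ₗ[R] F :=
    { toFun := fun x => i (q x)
      map_add' := fun x y => by simp
      map_smul' := fun r x => by simp [hsmul] }
  let γ : R := MonoidAlgebra.single ⟨g, Subgroup.mem_zpowers g⟩ 1
  have hγ : MonoidAlgebra.mapDomainRingHom ℤ f γ = MonoidAlgebra.single g 1 := by
    simp [γ, f]
  obtain ⟨r, hr⟩ : ∃ r : ℕ, LinearMap.trace R F e = r := by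
    rw [LinearMap.trace_eq_matrix_trace R (Module.Free.chooseBasis R F)]
    refine Matrix.exists_trace_eq_natCast_of_isIdempotentElem
      MonoidAlgebra.eq_zero_or_one_of_mul_self _ ?_
    rw [← LinearMap.toMatrix_comp]
    congr 1
    refine LinearMap.ext fun x => ?_
    simp [e, hqi']
  have h1 : LinearMap.trace ℤ P (Module.toModuleEnd ℤ P (MonoidAlgebra.single g (1 : ℤ))) =
      LinearMap.trace ℤ F ((γ • e).restrictScalars ℤ) := by
    have ha : (Module.toModuleEnd ℤ P (MonoidAlgebra.single g (1 : ℤ)) : Module.End ℤ P) =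
      (q.restrictScalars ℤ) ∘ₗ ((i.restrictScalars ℤ) ∘ₗ
        Module.toModuleEnd ℤ P (MonoidAlgebra.single g (1 : ℤ))) := by
      ext x
      simp [hqi']
    have hb : (γ • e).restrictScalars ℤ = ((i.restrictScalars ℤ) ∘ₗ
        Module.toModuleEnd ℤ P (MonoidAlgebra.single g (1 : ℤ))) ∘ₗ (q.restrictScalars ℤ) := by
      refine LinearMap.ext fun x => ?_
      simp [hsmul, hγ, e]
    rw [hb, ← LinearMap.trace_comp_comm', ← ha]
  rw [groupRingTrace_apply, h1, LinearMap.trace_int_eq_trace_trace, map_smul, hr, smul_eq_mul,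
    mul_comm, ← nsmul_eq_mul, map_nsmul]
  have h3 : (⟨g, Subgroup.mem_zpowers g⟩ : Subgroup.zpowers g) ≠ 1 := fun h =>
    hg (congrArg Subtype.val h)
  have h2 : groupRingTrace (Subgroup.zpowers g) R γ = 0 := by
    rw [groupRingTrace_self]
    simp [γ, h3]
  exact (congrArg (r • ·) h2).trans (smul_zero r)

/-! ### Splitting submodules up to an integer factor -/

/-- The quotient of W / U by its torsion is free, so W splits over it; the kernel of that projection
lies in U after multiplication by an integer killing the torsion. -/
theorem Submodule.exists_linearMap_int_smul {W : Type*} [AddCommGroup W] [Module.Finite ℤ W]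
    (U : Submodule ℤ W) :
    ∃ D : ℤ, 0 < D ∧ ∃ π : W →ₗ[ℤ] U, ∀ u : U, π u = D • u := by
  let T := Submodule.torsion ℤ (W ⧸ U)
  obtain ⟨D, hD, hD0⟩ := Submodule.annihilator_top_inter_nonZeroDivisors
    (R := ℤ) (M := T) (Submodule.torsion_isTorsion)
  have hDT : ∀ t ∈ T, D • t = 0 := fun t ht => by
    simpa using congrArg Subtype.val (Submodule.mem_annihilator.1 hD ⟨t, ht⟩ trivial)
  let p : W →ₗ[ℤ] (W ⧸ U) ⧸ T := T.mkQ ∘ₗ U.mkQ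
  have hp : Function.Surjective p := T.mkQ_surjective.comp U.mkQ_surjective
  obtain ⟨s, hs⟩ := Module.projective_lifting_property p LinearMap.id hp
  have hs' : ∀ y, p (s y) = y := fun y => by simpa using congrArg (fun k => k y) hs
  have hpU : ∀ u : U, p u = 0 := fun u => by
    have : U.mkQ u = 0 := by simp
    rw [LinearMap.comp_apply, this, map_zero]
  have hmem : ∀ x, (D * D) • (x - s (p x)) ∈ U := by
    intro x
    rw [mul_smul]
    refine U.smul_mem _ ?_
    rw [← Submodule.Quotient.mk_eq_zero, Submodule.Quotient.mk_smul]
    refine hDT _ ((Submodule.Quotient.mk_eq_zero T).1 ?_)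
    change p (x - s (p x)) = 0
    rw [map_sub, hs', sub_self]
  -- The square is taken only for positivity, since the sign of D is unknown.
  refine ⟨D * D, mul_self_pos.2 (nonZeroDivisors.ne_zero hD0),
    LinearMap.codRestrict U ((D * D) • (LinearMap.id - s ∘ₗ p)) hmem, fun u => ?_⟩
  ext
  simp [hpU, -zsmul_eq_mul]

/-- An integral form of Maschke's theorem: a submodule of a lattice is, up to a positive integer
factor, a direct summand. -/
theorem Submodule.exists_equivariant_smul {G W : Type*} [Group G] [Finite G] [AddCommGroup W]
    [Module (MonoidAlgebra ℤ G) W] [Module.Finite ℤ W] (U : Submodule (MonoidAlgebra ℤ G) W) :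
    ∃ D : ℤ, 0 < D ∧ ∃ π : W →ₗ[MonoidAlgebra ℤ G] U, ∀ u : U, π u = D • u := by
  have := Fintype.ofFinite G
  obtain ⟨D, hD, p, hp⟩ := (U.restrictScalars ℤ).exists_linearMap_int_smul
  let p' : W →ₗ[ℤ] U := p
  have hp' : ∀ u : U, p' u = D • u := hp
  refine ⟨Fintype.card G * D, by have := Fintype.card_pos (α := G); positivity,
    p'.sumOfConjugatesEquivariant G, fun u => ?_⟩
  rw [LinearMap.sumOfConjugatesEquivariant_apply]
  have h : ∀ g : G, p'.conjugate g (u : W) = D • u := by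
    intro g
    rw [LinearMap.conjugate_apply]
    have h1 : MonoidAlgebra.single g (1 : ℤ) • (u : W) =
      ((MonoidAlgebra.single g (1 : ℤ) • u : U) : W) := rfl
    rw [h1, hp', smul_comm, ← mul_smul, MonoidAlgebra.single_mul_single, inv_mul_cancel, one_mul,
      ← MonoidAlgebra.one_def, one_smul]
  simp [h, mul_smul]

/-! ### Augmentation and norm element -/

/-- The augmentation of the integral group ring. -/
noncomputable def groupRingAug (G : Type*) [Group G] : MonoidAlgebra ℤ G →+* ℤ :=
  (MonoidAlgebra.lift ℤ ℤ G 1).toRingHom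

@[simp]
theorem groupRingAug_single {G : Type*} [Group G] (g : G) (k : ℤ) :
    groupRingAug G (MonoidAlgebra.single g k) = k := by
  simp [groupRingAug]

/-- The norm element of the group ring of a finite group. -/
noncomputable def groupRingNorm (G : Type*) [Group G] [Finite G] : MonoidAlgebra ℤ G :=
  haveI := Fintype.ofFinite G
  ∑ g : G, MonoidAlgebra.single g 1

theorem groupRingNorm_eq {G : Type*} [Group G] [Fintype G] :
    groupRingNorm G = ∑ g : G, MonoidAlgebra.single g 1 := by
  unfold groupRingNorm
  congr!

theorem groupRingNorm_mul {G : Type*} [Group G] [Finite G] (x : MonoidAlgebra ℤ G) :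
    groupRingNorm G * x = groupRingAug G x • groupRingNorm G := by
  have := Fintype.ofFinite G
  induction x using MonoidAlgebra.induction_linear with
  | zero => simp
  | add x y hx hy => rw [mul_add, hx, hy, map_add, add_smul]
  | single g k =>
    simp only [groupRingNorm_eq, Finset.sum_mul, MonoidAlgebra.single_mul_single, Finset.smul_sum,
      groupRingAug_single, MonoidAlgebra.smul_single]
    exact Fintype.sum_bijective (· * g) (Group.mulRight_bijective g) _ _ fun i => by
      rw [one_mul, smul_eq_mul, mul_one]

theorem mul_groupRingNorm {G : Type*} [Group G] [Finite G] (x : MonoidAlgebra ℤ G) :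
    x * groupRingNorm G = groupRingAug G x • groupRingNorm G := by
  have := Fintype.ofFinite G
  induction x using MonoidAlgebra.induction_linear with
  | zero => simp
  | add x y hx hy => rw [add_mul, hx, hy, map_add, add_smul]
  | single g k =>
    simp only [groupRingNorm_eq, Finset.mul_sum, MonoidAlgebra.single_mul_single, Finset.smul_sum,
      groupRingAug_single, MonoidAlgebra.smul_single]
    exact Fintype.sum_bijective (g * ·) (Group.mulLeft_bijective g) _ _ fun i => by
      rw [smul_eq_mul]

@[simp]
theorem groupRingAug_norm {G : Type*} [Group G] [Finite G] :
    groupRingAug G (groupRingNorm G) = Nat.card G := by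
  have := Fintype.ofFinite G
  simp [groupRingNorm_eq]

theorem groupRingNorm_coeff {G : Type*} [Group G] [Finite G] (g : G) :
    (groupRingNorm G).coeff g = 1 := by
  classical
  have := Fintype.ofFinite G
  simp [groupRingNorm_eq, Finsupp.finsetSum_apply, Finsupp.single_apply]

theorem Submodule.finrank_int_lt_iff {M : Type*} [AddCommGroup M] [Module.Finite ℤ M]
    {A B : Submodule ℤ M} (h : A ≤ B) :
    Module.finrank ℤ A < Module.finrank ℤ B ↔ ∃ x ∈ B, ∀ n : ℤ, n ≠ 0 → n • x ∉ A := by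
  have h1 := Submodule.finrank_quotient_add_finrank (A.submoduleOf B)
  rw [(Submodule.submoduleOfEquivOfLe h).finrank_eq] at h1
  have h2 : Module.finrank ℤ A < Module.finrank ℤ B ↔
    ¬ Module.finrank ℤ (B ⧸ A.submoduleOf B) = 0 := by omega
  rw [h2, Module.finrank_eq_zero_iff]
  push Not
  constructor
  · rintro ⟨x, hx⟩
    obtain ⟨x, rfl⟩ := Submodule.mkQ_surjective _ x
    refine ⟨x, x.2, fun n hn hA => hx n hn ?_⟩
    rw [← map_smul]
    exact (Submodule.Quotient.mk_eq_zero _).2 hA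
  · rintro ⟨x, hxB, hx⟩
    refine ⟨Submodule.mkQ _ ⟨x, hxB⟩, fun n hn h0 => hx n hn ?_⟩
    rw [← map_smul] at h0
    exact (Submodule.Quotient.mk_eq_zero (A.submoduleOf B)).1 h0

/-! ### Lattices with character -1 away from the identity -/

section

variable {G W : Type*} [Group G] [AddCommGroup W] [Module (MonoidAlgebra ℤ G) W]

/-- The character is (rank W + 1) times the indicator function of the identity, minus the trivial
character. -/
theorem groupRingTrace_of_single_eq_neg_one [Module.Finite ℤ W] [Module.Free ℤ W]
    (htr : ∀ g : G, g ≠ 1 → groupRingTrace G W (MonoidAlgebra.single g 1) = -1)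
    (x : MonoidAlgebra ℤ G) :
    groupRingTrace G W x = x.coeff 1 * (Module.finrank ℤ W + 1) - groupRingAug G x := by
  classical
  induction x using MonoidAlgebra.induction_linear with
  | zero => simp
  | add x y hx hy =>
    rw [map_add, map_add, hx, hy, MonoidAlgebra.coeff_add, Finsupp.add_apply]
    ring
  | single g k =>
    rw [groupRingTrace_single, groupRingAug_single, MonoidAlgebra.coeff_single]
    by_cases hg : g = 1
    · subst hg
      have : groupRingTrace G W (MonoidAlgebra.single 1 1) = Module.finrank ℤ W := by
        rw [← MonoidAlgebra.one_def, groupRingTrace_apply, map_one, LinearMap.trace_one]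
      rw [this, Finsupp.single_eq_same]
      ring
    · rw [htr g hg, Finsupp.single_eq_of_ne (Ne.symm hg)]
      ring

/-- The norm N satisfies N² = |G| N, so its trace rank W + 1 - |G| is |G| times a rank, hence
nonnegative. -/
theorem card_le_finrank_add_one [Finite G] [Module.Finite ℤ W] [Module.Free ℤ W]
    (htr : ∀ g : G, g ≠ 1 → groupRingTrace G W (MonoidAlgebra.single g 1) = -1) :
    Nat.card G ≤ Module.finrank ℤ W + 1 := by
  have h1 := groupRingTrace_of_single_eq_neg_one htr (groupRingNorm G)
  rw [groupRingTrace_eq_mul_finrank (groupRingNorm G) (Nat.card G)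
    (by rw [groupRingNorm_mul, groupRingAug_norm]), groupRingNorm_coeff, groupRingAug_norm] at h1
  zify
  nlinarith

/-- The elements of the augmentation ideal annihilating `w`. -/
noncomputable def augAnnihilator (w : W) : Submodule (MonoidAlgebra ℤ G) (MonoidAlgebra ℤ G) :=
  RingHom.ker (groupRingAug G) ⊓ LinearMap.ker (LinearMap.toSpanSingleton (MonoidAlgebra ℤ G) W w)

theorem mem_augAnnihilator {w : W} {x : MonoidAlgebra ℤ G} :
    x ∈ augAnnihilator w ↔ groupRingAug G x = 0 ∧ x • w = 0 := Iff.rfl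

/-- A nonzero annihilator yields f with f² = Df and fw = 0. Rank counting shows that fW is too large
to lie rationally in fIw, where I is the augmentation ideal. Adding to w a vector that comes from fW
and lies in a complement of Iw destroys f and no annihilator is gained. -/
theorem exists_finrank_augAnnihilator_lt [Finite G] [Module.Finite ℤ W] [Module.Free ℤ W]
    (htr : ∀ g : G, g ≠ 1 → groupRingTrace G W (MonoidAlgebra.single g 1) = -1)
    (w : W) (hw : augAnnihilator (G := G) w ≠ ⊥) :
    ∃ w' : W, Module.finrank ℤ (augAnnihilator (G := G) w') <
      Module.finrank ℤ (augAnnihilator (G := G) w) := by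
  obtain ⟨D, hD, κ, hκ⟩ := (augAnnihilator (G := G) w).exists_equivariant_smul
  set f : MonoidAlgebra ℤ G := (κ 1 : MonoidAlgebra ℤ G) with hf
  obtain ⟨hfaug, hfw⟩ := mem_augAnnihilator.1 (κ 1).2
  rw [← hf] at hfaug hfw
  have hkf : ∀ k ∈ augAnnihilator (G := G) w, k * f = D • k := by
    intro k hk
    have h1 := congrArg Subtype.val (hκ ⟨k, hk⟩)
    have h2 : κ k = k • κ 1 := by rw [← map_smul, smul_eq_mul, mul_one]
    rw [h2] at h1
    exact h1
  have hff : f * f = D • f := hkf f (κ 1).2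
  have hf0 : f ≠ 0 := by
    intro h0
    refine hw ((Submodule.eq_bot_iff _).2 fun k hk => ?_)
    have := hkf k hk
    rw [h0, mul_zero] at this
    exact (smul_eq_zero.1 this.symm).resolve_left hD.ne'
  let Lf : W →ₗ[ℤ] W := Module.toModuleEnd ℤ W f
  let Lf' : MonoidAlgebra ℤ G →ₗ[ℤ] MonoidAlgebra ℤ G :=
    Module.toModuleEnd ℤ (MonoidAlgebra ℤ G) f
  let ρ : MonoidAlgebra ℤ G →ₗ[MonoidAlgebra ℤ G] W := LinearMap.toSpanSingleton _ W w
  let I : Submodule (MonoidAlgebra ℤ G) (MonoidAlgebra ℤ G) := RingHom.ker (groupRingAug G)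
  let U : Submodule (MonoidAlgebra ℤ G) W := I.map ρ
  let A₀ : Submodule ℤ (MonoidAlgebra ℤ G) := (I.restrictScalars ℤ).map Lf'
  let A : Submodule ℤ W := A₀.map (ρ.restrictScalars ℤ)
  have hAf : ∀ x ∈ U, f • x ∈ A := by
    rintro _ ⟨x, hx, rfl⟩
    exact ⟨f * x, ⟨x, hx, rfl⟩, (mul_smul f x w)⟩
  have hAB : A ≤ LinearMap.range Lf := by
    rintro _ ⟨_, ⟨x, hx, rfl⟩, rfl⟩
    exact ⟨x • w, (mul_smul f x w).symm⟩
  -- The map fI → fIw kills f² = Df ≠ 0, so the rank drops strictly. Dividing traces by D compares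
  -- the rank of fℤG, |G| f₁ / D, with that of fW, (rank W + 1) f₁ / D.
  have hrank : Module.finrank ℤ A < Module.finrank ℤ (LinearMap.range Lf) := by
    have h1 : Module.finrank ℤ A < Module.finrank ℤ A₀ := by
      have h2 := Submodule.finrank_quotient_add_finrank
        (LinearMap.ker ((ρ.restrictScalars ℤ).domRestrict A₀))
      rw [(LinearMap.quotKerEquivRange _).finrank_eq, LinearMap.range_domRestrict] at h2
      have h3 : Module.finrank ℤ (LinearMap.ker ((ρ.restrictScalars ℤ).domRestrict A₀)) ≠ 0 := by
        intro h0
        have h4 := Submodule.finrank_eq_zero.1 h0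
        have h5 : (⟨f * f, f, hfaug, rfl⟩ : A₀) ∈
            LinearMap.ker ((ρ.restrictScalars ℤ).domRestrict A₀) := by
          change (f * f) • w = 0
          rw [mul_smul, hfw, smul_zero]
        rw [h4, Submodule.mem_bot] at h5
        have h6 : f * f = 0 := congrArg Subtype.val h5
        rw [hff] at h6
        exact hf0 ((smul_eq_zero.1 h6).resolve_left hD.ne')
      change _ + _ = Module.finrank ℤ A₀ at h2
      change Module.finrank ℤ (A₀.map (ρ.restrictScalars ℤ)) < _
      omega
    have h2 : Module.finrank ℤ A₀ ≤ Module.finrank ℤ (LinearMap.range Lf') :=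
      Submodule.finrank_mono (LinearMap.map_le_range)
    have h3 := groupRingTrace_eq_mul_finrank (M := MonoidAlgebra ℤ G) f D hff
    have h4 := groupRingTrace_eq_mul_finrank (M := W) f D hff
    rw [groupRingTrace_self] at h3
    rw [groupRingTrace_of_single_eq_neg_one htr, hfaug, sub_zero] at h4
    have h5 : Module.finrank ℤ (LinearMap.range Lf') ≤ Module.finrank ℤ (LinearMap.range Lf) := by
      have h6 := card_le_finrank_add_one htr
      zify at h6 ⊢
      have h7 : (0 : ℤ) < Nat.card G := by exact_mod_cast Nat.card_pos
      have h8 : 0 ≤ f.coeff 1 := by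
        by_contra! h9
        have h10 := mul_neg_of_pos_of_neg h7 h9
        have h11 : 0 ≤ D * (Module.finrank ℤ (LinearMap.range Lf') : ℤ) := by positivity
        exact absurd (h3 ▸ h11) (not_le.2 h10)
      refine le_of_mul_le_mul_left ?_ hD
      calc D * (Module.finrank ℤ (LinearMap.range Lf') : ℤ) = Nat.card G * f.coeff 1 := h3.symm
        _ ≤ f.coeff 1 * (Module.finrank ℤ W + 1) := by nlinarith
        _ = _ := h4
    omega
  obtain ⟨_, ⟨v, rfl⟩, hv⟩ := (Submodule.finrank_int_lt_iff hAB).1 hrank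
  change ∀ n : ℤ, n ≠ 0 → n • f • v ∉ A at hv
  obtain ⟨d, hd, π, hπ⟩ := U.exists_equivariant_smul
  let σ : W →ₗ[MonoidAlgebra ℤ G] W := d • LinearMap.id - U.subtype ∘ₗ π
  have hσ : ∀ y, σ y = d • y - π y := fun y => rfl
  have hσf : σ (f • v) ≠ 0 := by
    intro h0
    rw [hσ, sub_eq_zero] at h0
    have h1 := hAf _ (π (f • v)).2
    rw [← h0, smul_comm, ← mul_smul, hff, smul_assoc, ← mul_smul] at h1
    exact hv _ (mul_ne_zero hd.ne' hD.ne') h1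
  have hπσ : ∀ y, π (σ y) = 0 := by
    intro y
    rw [hσ, map_sub, map_zsmul, hπ, sub_self]
  refine ⟨w + σ (f • v), (Submodule.finrank_int_lt_iff (M := MonoidAlgebra ℤ G)
    (A := (augAnnihilator (G := G) _).restrictScalars ℤ)
    (B := (augAnnihilator (G := G) _).restrictScalars ℤ) ?_).2 ⟨f, (κ 1).2, ?_⟩⟩
  -- The terms xw and xσ(fv) lie in U and in the kernel of π, which meet in zero, so both vanish
  -- when their sum does.
  · rintro x ⟨hx, hxw⟩
    refine ⟨hx, ?_⟩
    change x • (w + _) = 0 at hxw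
    change x • w = 0
    rw [smul_add, ← map_smul, add_eq_zero_iff_eq_neg, ← map_neg] at hxw
    have h1 := hπ ⟨x • w, x, hx, rfl⟩
    have h2 : ((π (x • w) : U) : W) = d • (x • w) := congrArg Subtype.val h1
    have h3 : π (x • w) = 0 := by rw [hxw, hπσ]
    rw [h3, Submodule.coe_zero] at h2
    exact (smul_eq_zero.1 h2.symm).resolve_left hd.ne'
  · rintro n hn ⟨-, hnf⟩
    change (n • f) • (w + σ (f • v)) = 0 at hnf
    rw [smul_assoc, smul_add, hfw, zero_add, ← map_smul, ← mul_smul, hff, smul_assoc,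
      map_zsmul, ← mul_smul] at hnf
    exact hσf ((smul_eq_zero.1 hnf).resolve_left (mul_ne_zero hn hD.ne'))

/-- A lattice with character `-1` away from the identity contains, up to isogeny, the complement
of the trivial module in the group ring as a direct summand. -/
theorem exists_apply_eq_smul_card_sub_norm [Finite G] [Module.Finite ℤ W] [Module.Free ℤ W]
    (htr : ∀ g : G, g ≠ 1 → groupRingTrace G W (MonoidAlgebra.single g 1) = -1) :
    ∃ (w : W) (q : W →ₗ[MonoidAlgebra ℤ G] MonoidAlgebra ℤ G) (d : ℤ), 0 < d ∧
      q w = d • ((Nat.card G : MonoidAlgebra ℤ G) - groupRingNorm G) := by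
  let r : W → ℕ := fun w => Module.finrank ℤ (augAnnihilator (G := G) w)
  -- By the descent just proved, minimal annihilator rank means zero annihilator; then I ≅ Iw, and
  -- projecting onto Iw up to a factor gives q.
  obtain ⟨w, hw⟩ : ∃ w, ∀ w', r w ≤ r w' := ⟨Function.argmin r, fun w' => Function.argmin_le r w'⟩
  have hbot : augAnnihilator (G := G) w = ⊥ := by
    by_contra h
    obtain ⟨w', hw'⟩ := exists_finrank_augAnnihilator_lt htr w h
    exact absurd (hw w') (not_le.2 hw')
  let I : Submodule (MonoidAlgebra ℤ G) (MonoidAlgebra ℤ G) := RingHom.ker (groupRingAug G)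
  let ρ : MonoidAlgebra ℤ G →ₗ[MonoidAlgebra ℤ G] W := LinearMap.toSpanSingleton _ W w
  let E : I ≃ₗ[MonoidAlgebra ℤ G] I.map ρ := LinearEquiv.ofBijective (ρ.submoduleMap I)
    ⟨by
      rw [← LinearMap.ker_eq_bot, Submodule.eq_bot_iff]
      rintro ⟨x, hx⟩ h0
      have h1 : x ∈ augAnnihilator (G := G) w := ⟨hx, congrArg Subtype.val h0⟩
      rw [hbot] at h1
      exact Subtype.ext h1, LinearMap.submoduleMap_surjective _ _⟩
  obtain ⟨d, hd, π, hπ⟩ := (I.map ρ).exists_equivariant_smul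
  have hI : (Nat.card G : MonoidAlgebra ℤ G) - groupRingNorm G ∈ I := by
    change groupRingAug G _ = 0
    simp
  refine ⟨ρ ((Nat.card G : MonoidAlgebra ℤ G) - groupRingNorm G),
    I.subtype ∘ₗ E.symm.toLinearMap ∘ₗ π, d, hd, ?_⟩
  have h1 : π (ρ ((Nat.card G : MonoidAlgebra ℤ G) - groupRingNorm G)) = d • E ⟨_, hI⟩ :=
    hπ (E ⟨_, hI⟩)
  change ((E.symm (π (ρ _)) : I) : MonoidAlgebra ℤ G) = _
  rw [h1, map_zsmul, LinearEquiv.symm_apply_apply]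
  rfl

end

/-! ### Stable range one for finite rings -/

/-- Take c for which right multiplication by a + cb has the fewest zeros. If its kernel K were
nonzero, either part of Rb outside the image could be used to shrink K, or multiplication would be
surjective on the right ideal fR, where f is a right identity for K, and then injective there by
finiteness. -/
theorem exists_isUnit_add_mul_of_isSemisimpleRing {R : Type*} [Ring R] [Finite R]
    [IsSemisimpleRing R] (a b s t : R) (h : s * a + t * b = 1) : ∃ c, IsUnit (a + c * b) := by
  let r : R → ℕ := fun c => Nat.card {x : R // x * (a + c * b) = 0}
  obtain ⟨c₀, hc₀⟩ : ∃ c, ∀ c', r c ≤ r c' := ⟨Function.argmin r, fun c => Function.argmin_le r c⟩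
  refine ⟨c₀, ?_⟩
  set a' := a + c₀ * b with ha'
  have h' : s * a' + (t - s * c₀) * b = 1 := by rw [← h, ha']; noncomm_ring
  suffices hK : ∀ x, x * a' = 0 → x = 0 by
    have hinj : Function.Injective (· * a') := fun x y hxy =>
      sub_eq_zero.1 (hK _ (by rw [sub_mul]; exact sub_eq_zero.2 hxy))
    obtain ⟨y, hy⟩ := (Finite.injective_iff_surjective.1 hinj) 1
    exact IsUnit.of_mul_eq_one_right y hy
  let K : Submodule R R := LinearMap.ker (LinearMap.toSpanSingleton R R a')
  let A : Submodule R R := LinearMap.range (LinearMap.toSpanSingleton R R a')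
  let B : Submodule R R := LinearMap.range (LinearMap.toSpanSingleton R R b)
  obtain ⟨K', hKK'⟩ := exists_isCompl K
  obtain ⟨f, hf, f', hf', hff'⟩ := Submodule.mem_sup.1 (hKK'.sup_eq_top ▸ Submodule.mem_top :
    (1 : R) ∈ K ⊔ K')
  have hKf : ∀ x ∈ K, x * f = x := by
    intro x hx
    have h1 : x - x * f = x * f' := by rw [sub_eq_iff_eq_add, ← mul_add, add_comm f', hff', mul_one]
    have h2 : x - x * f ∈ K ⊓ K' :=
      ⟨K.sub_mem hx (K.smul_mem x hf), h1 ▸ K'.smul_mem x hf'⟩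
    rw [hKK'.inf_eq_bot, Submodule.mem_bot, sub_eq_zero] at h2
    exact h2.symm
  have hfa : f * a' = 0 := hf
  obtain ⟨C', hC'⟩ := exists_isCompl (A ⊓ B)
  by_cases hC : ∃ c ∈ C' ⊓ B, f * c ≠ 0
  · exfalso
    obtain ⟨_, ⟨hcC, d, rfl⟩, hfc⟩ := hC
    change f * (d * b) ≠ 0 at hfc
    -- For such x the element x f d b lies in both A ⊓ B and its complement C', so it vanishes. The
    -- new kernel is thus inside K, and it misses f.
    have hker : ∀ x, x * (a + (c₀ + f * d) * b) = 0 → x ∈ K ∧ x * (f * (d * b)) = 0 := by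
      intro x hx
      have h1 : x * a' = -(x * (f * (d * b))) := by
        rw [eq_neg_iff_add_eq_zero, ← hx, ha']
        noncomm_ring
      have h2 : x * (f * (d * b)) ∈ (A ⊓ B) ⊓ C' := by
        refine ⟨⟨⟨-x, ?_⟩, ⟨x * f * d, ?_⟩⟩, ?_⟩
        · change -x * a' = _
          rw [neg_mul, h1, neg_neg]
        · change x * f * d * b = _
          noncomm_ring
        · rw [← mul_assoc]
          exact C'.smul_mem _ hcC
      rw [hC'.inf_eq_bot, Submodule.mem_bot] at h2
      rw [h2, neg_zero] at h1
      exact ⟨h1, h2⟩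
    refine absurd (hc₀ (c₀ + f * d)) (not_le.2 ?_)
    refine Set.ncard_lt_ncard (s := {x : R | x * (a + (c₀ + f * d) * b) = 0})
      (t := {x : R | x * a' = 0}) ⟨fun x hx => (hker x hx).1, fun hsub => hfc ?_⟩ (Set.toFinite _)
    have h3 := (hker f (hsub hfa)).2
    rwa [← mul_assoc, hKf f hf] at h3
  · push Not at hC
    have hsurj : Function.Surjective
        (fun y : {y : R // ∃ z, y = f * z} => (⟨y.1 * a', by
          obtain ⟨_, z, rfl⟩ := y
          exact ⟨z * a', mul_assoc _ _ _⟩⟩ : {y : R // ∃ z, y = f * z})) := by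
      rintro ⟨_, z, rfl⟩
      obtain ⟨u, ⟨⟨u', hu'⟩, hu⟩, v, hv, huv⟩ :=
        Submodule.mem_sup.1 (hC'.sup_eq_top ▸ Submodule.mem_top :
          z * ((t - s * c₀) * b) ∈ (A ⊓ B) ⊔ C')
      change u' * a' = u at hu'
      have hvB : v ∈ B := by
        rw [← add_sub_cancel_left u v, huv]
        exact B.sub_mem ⟨z * (t - s * c₀), mul_assoc _ _ _⟩ hu
      refine ⟨⟨f * (z * s + u'), _, rfl⟩, Subtype.ext ?_⟩
      change f * (z * s + u') * a' = f * z
      have h4 : z = z * s * a' + (u + v) := by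
        rw [huv, mul_assoc, ← mul_add, h', mul_one]
      have h5 : f * v = 0 := hC v ⟨hv, hvB⟩
      refine Eq.symm ((congrArg (f * ·) h4).trans ?_)
      simp only [mul_add, h5, add_zero, ← hu', add_mul, mul_assoc]
    have hinj := Finite.injective_iff_surjective.2 hsurj
    have hf0 : f = 0 := by
      have := @hinj ⟨f, 1, (mul_one f).symm⟩ ⟨0, 0, (mul_zero f).symm⟩
        (Subtype.ext (by simp [hfa]))
      exact congrArg Subtype.val this
    intro x hx
    rw [← hKf x hx, hf0, mul_zero]

/-- Finite rings have stable range one. -/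
theorem exists_isUnit_add_mul_of_finite {R : Type*} [Ring R] [Finite R] (a b s t : R)
    (h : s * a + t * b = 1) : ∃ c, IsUnit (a + c * b) := by
  let J := Ring.jacobson R
  have : Finite (R ⧸ J) := Quotient.finite _
  let p : R →+* R ⧸ J := Ideal.Quotient.mk J
  obtain ⟨c, hc⟩ := exists_isUnit_add_mul_of_isSemisimpleRing (p a) (p b) (p s) (p t)
    (by rw [← map_mul, ← map_mul, ← map_add, h, map_one])
  obtain ⟨c, rfl⟩ := Ideal.Quotient.mk_surjective c
  refine ⟨c, ?_⟩
  obtain ⟨w, hw⟩ := hc.exists_left_inv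
  obtain ⟨w, rfl⟩ := Ideal.Quotient.mk_surjective w
  have h1 : w * (a + c * b) - 1 ∈ J := by
    rw [← Ideal.Quotient.eq_zero_iff_mem]
    change p _ = 0
    rw [map_sub, map_mul, map_add, map_mul, map_one, sub_eq_zero]
    exact hw
  -- Units lift along the quotient because the Jacobson radical is nilpotent.
  obtain ⟨n, hn⟩ := IsSemiprimaryRing.isNilpotent (R := R)
  have h2 : IsNilpotent (w * (a + c * b) - 1) := ⟨n, by
    have := Ideal.pow_mem_pow h1 n
    rwa [hn] at this⟩
  have h3 : IsUnit (w * (a + c * b)) := by simpa using h2.isUnit_one_add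
  obtain ⟨v, hv⟩ := h3.exists_left_inv
  exact IsUnit.of_mul_eq_one_right (v * w) (by rw [mul_assoc, hv])

/-- Finite rings have stable range one. -/
theorem exists_isUnit_add_mul_of_finite' {R : Type*} [Ring R] [Finite R] (a b s t : R)
    (h : a * s + b * t = 1) : ∃ c, IsUnit (a + b * c) := by
  have : Finite Rᵐᵒᵖ := Finite.of_equiv R MulOpposite.opEquiv
  obtain ⟨c, hc⟩ := exists_isUnit_add_mul_of_finite (MulOpposite.op a) (MulOpposite.op b)
    (MulOpposite.op s) (MulOpposite.op t) (by
      rw [← MulOpposite.op_mul, ← MulOpposite.op_mul, ← MulOpposite.op_add, h, MulOpposite.op_one])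
  exact ⟨c.unop, by simpa using hc.unop⟩

theorem finite_groupRing_zmod {G : Type*} [Finite G] {m : ℕ} [NeZero m] : Finite (MonoidAlgebra (ZMod m) G) :=
  Finite.of_injective (fun x (g : G) => x.coeff g) fun x y h => by
    ext g
    exact congrFun h g

/-! ### Reduction of the group ring modulo an integer -/

section reduction

variable (G : Type*) [Group G] (m : ℕ)

/-- Reduction of the integral group ring modulo `m`. -/
noncomputable def groupRingRed : MonoidAlgebra ℤ G →+* MonoidAlgebra (ZMod m) G :=
  MonoidAlgebra.mapRingHom G (Int.castRingHom (ZMod m))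

variable {G m}

theorem groupRingRed_coeff (x : MonoidAlgebra ℤ G) (g : G) :
    (groupRingRed G m x).coeff g = (x.coeff g : ZMod m) := by
  simp [groupRingRed]

theorem groupRingRed_eq_zero {x : MonoidAlgebra ℤ G} (hx : groupRingRed G m x = 0) :
    ∃ y : MonoidAlgebra ℤ G, x = (m : ℤ) • y := by
  have h : ∀ g, (m : ℤ) ∣ x.coeff g := fun g => by
    have := groupRingRed_coeff (m := m) x g
    rw [hx] at this
    exact (ZMod.intCast_zmod_eq_zero_iff_dvd _ _).1 this.symm
  refine ⟨MonoidAlgebra.ofCoeff (x.coeff.mapRange (· / (m : ℤ)) (by simp)), ?_⟩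
  ext g
  exact (Int.mul_ediv_cancel' (h g)).symm

theorem groupRingRed_surjective : Function.Surjective (groupRingRed G m) := by
  intro y
  induction y using MonoidAlgebra.induction_linear with
  | zero => exact ⟨0, map_zero _⟩
  | add x y hx hy =>
    obtain ⟨x, rfl⟩ := hx
    obtain ⟨y, rfl⟩ := hy
    exact ⟨x + y, map_add _ _ _⟩
  | single g k =>
    obtain ⟨k, rfl⟩ := ZMod.intCast_surjective k
    exact ⟨MonoidAlgebra.single g k, by simp [groupRingRed]⟩

/-- If `a` is a unit modulo `m`, then its right ideal contains an integer congruent to `1`. -/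
theorem exists_mul_eq_of_isUnit_red [Finite G] {a : MonoidAlgebra ℤ G}
    (ha : IsUnit (groupRingRed G m a)) :
    ∃ (l : ℤ) (c : MonoidAlgebra ℤ G), a * c = ((1 + m * l : ℤ) : MonoidAlgebra ℤ G) := by
  let A : Submodule ℤ (MonoidAlgebra ℤ G) := LinearMap.range (LinearMap.mulLeft ℤ a)
  obtain ⟨u, hu⟩ := ha.exists_right_inv
  obtain ⟨u, rfl⟩ := groupRingRed_surjective u
  rw [← map_mul, ← sub_eq_zero, ← map_one (groupRingRed G m), ← map_sub] at hu
  obtain ⟨z, hz⟩ := groupRingRed_eq_zero hu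
  -- Nakayama: the quotient M = ℤG / aℤG satisfies M = mM, so an integer congruent to 1 modulo m
  -- kills it.
  obtain ⟨k, hk, hkA⟩ := Submodule.exists_sub_one_mem_and_smul_eq_zero_of_fg_of_le_smul
    (Ideal.span {(m : ℤ)}) (⊤ : Submodule ℤ (MonoidAlgebra ℤ G ⧸ A)) Module.Finite.fg_top (by
      rintro y -
      obtain ⟨y, rfl⟩ := A.mkQ_surjective y
      have h1 : y = a * (u * y) - (m : ℤ) • (z * y) := by
        rw [← smul_mul_assoc, ← hz]
        noncomm_ring
      have h2 : A.mkQ y = (m : ℤ) • A.mkQ (-(z * y)) := by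
        conv_lhs => rw [h1]
        rw [map_sub, ← map_smul, smul_neg, map_neg, sub_eq_add_neg]
        convert zero_add _
        exact (Submodule.Quotient.mk_eq_zero A).2 ⟨u * y, rfl⟩
      rw [h2]
      exact Submodule.smul_mem_smul (Ideal.mem_span_singleton_self _) trivial)
  obtain ⟨l, hl⟩ := Ideal.mem_span_singleton.1 hk
  have h1 := hkA (A.mkQ 1) trivial
  rw [← map_smul] at h1
  obtain ⟨c, hc⟩ := (Submodule.Quotient.mk_eq_zero A).1 h1
  refine ⟨l, c, ?_⟩
  rw [← hl, add_sub_cancel]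
  exact hc.trans (by simp)

end reduction

/-! ### Transvections and unimodular elements -/

section unimodular

variable {G : Type*} [Group G] {P : Type*} [AddCommGroup P] [Module (MonoidAlgebra ℤ G) P]

/-- Two elements of `P ⊕ ℤG ⊕ ℤG` are related if an automorphism which is the identity modulo
`J ⊕ ℤG ⊕ ℤG` takes one to the other. -/
def IsConjugateModulo (J : Submodule (MonoidAlgebra ℤ G) P)
    (v v' : (P × MonoidAlgebra ℤ G) × MonoidAlgebra ℤ G) : Prop :=
  ∃ α : ((P × MonoidAlgebra ℤ G) × MonoidAlgebra ℤ G) ≃ₗ[MonoidAlgebra ℤ G]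
    ((P × MonoidAlgebra ℤ G) × MonoidAlgebra ℤ G), (∀ z, (α z).1.1 - z.1.1 ∈ J) ∧ α v = v'

/-- An element of a module is unimodular if a linear form takes the value one on it. -/
def IsUnimodular {R M : Type*} [Ring R] [AddCommGroup M] [Module R M] (v : M) : Prop :=
  ∃ H : M →ₗ[R] R, H v = 1

namespace IsConjugateModulo

variable {J : Submodule (MonoidAlgebra ℤ G) P}
  {u v v' : (P × MonoidAlgebra ℤ G) × MonoidAlgebra ℤ G}

theorem refl (v : (P × MonoidAlgebra ℤ G) × MonoidAlgebra ℤ G) : IsConjugateModulo J v v :=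
  ⟨LinearEquiv.refl _ _, fun z => by simp, rfl⟩

theorem trans (h : IsConjugateModulo J u v) (h' : IsConjugateModulo J v v') :
    IsConjugateModulo J u v' := by
  obtain ⟨α, hα, rfl⟩ := h
  obtain ⟨β, hβ, rfl⟩ := h'
  refine ⟨α.trans β, fun z => ?_, rfl⟩
  have := J.add_mem (hβ (α z)) (hα z)
  rwa [sub_add_sub_cancel] at this

theorem isUnimodular (h : IsConjugateModulo J v v')
    (hv : IsUnimodular (R := MonoidAlgebra ℤ G) v) :
    IsUnimodular (R := MonoidAlgebra ℤ G) v' := by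
  obtain ⟨α, -, rfl⟩ := h
  obtain ⟨H, hH⟩ := hv
  exact ⟨H ∘ₗ α.symm.toLinearMap, by simpa using hH⟩

theorem mem (h : IsConjugateModulo J v v') (hv : v.1.1 ∈ J) : v'.1.1 ∈ J := by
  obtain ⟨α, hα, rfl⟩ := h
  simpa using J.add_mem (hα v) hv

/-- All the transvections below have the form 1 + f with f² = 0, whose inverse is 1 - f. -/
theorem add_apply (f : ((P × MonoidAlgebra ℤ G) × MonoidAlgebra ℤ G) →ₗ[MonoidAlgebra ℤ G]
    ((P × MonoidAlgebra ℤ G) × MonoidAlgebra ℤ G)) (hf : ∀ z, f (f z) = 0)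
    (hJ : ∀ z, (f z).1.1 ∈ J) (v : (P × MonoidAlgebra ℤ G) × MonoidAlgebra ℤ G) :
    IsConjugateModulo J v (v + f v) :=
  ⟨LinearEquiv.ofLinearMap (LinearMap.id + f) (LinearMap.id - f)
    (LinearMap.ext fun z => by simp [hf]) (LinearMap.ext fun z => by simp [hf]),
    fun z => by simpa using hJ z, rfl⟩

theorem swap (x : P) (a b : MonoidAlgebra ℤ G) :
    IsConjugateModulo J ((x, a), b) ((x, b), a) :=
  ⟨(LinearEquiv.prodAssoc _ _ _ _).trans (((LinearEquiv.refl _ _).prodCongr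
    (LinearEquiv.prodComm _ _ _)).trans (LinearEquiv.prodAssoc _ _ _ _).symm),
    fun z => by
      change z.1.1 - z.1.1 ∈ J
      simp, rfl⟩

theorem add_left (h : P →ₗ[MonoidAlgebra ℤ G] MonoidAlgebra ℤ G) (c : MonoidAlgebra ℤ G)
    (x : P) (a b : MonoidAlgebra ℤ G) :
    IsConjugateModulo J ((x, a), b) ((x, a + (h x + b * c)), b) := by
  have := add_apply (J := J) (LinearMap.inl _ _ _ ∘ₗ LinearMap.inr _ _ _ ∘ₗ
    (h.comp (LinearMap.fst _ _ _ ∘ₗ LinearMap.fst _ _ _) +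
      (LinearMap.toSpanSingleton _ _ c).comp (LinearMap.snd _ _ _)))
    (fun z => by simp) (fun z => by simp) ((x, a), b)
  simpa using this

theorem add_right (h : P →ₗ[MonoidAlgebra ℤ G] MonoidAlgebra ℤ G) (c : MonoidAlgebra ℤ G)
    (x : P) (a b : MonoidAlgebra ℤ G) :
    IsConjugateModulo J ((x, a), b) ((x, a), b + (h x + a * c)) :=
  (swap x a b).trans ((add_left h c x b a).trans (swap _ _ _))

theorem add_fst {y z : P} (hy : y ∈ J) (hz : z ∈ J) (x : P) (a b : MonoidAlgebra ℤ G) :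
    IsConjugateModulo J ((x, a), b) ((x + (a • y + b • z), a), b) := by
  have := add_apply (J := J) (LinearMap.inl _ _ _ ∘ₗ LinearMap.inl _ _ _ ∘ₗ
    ((LinearMap.toSpanSingleton _ _ y).comp (LinearMap.snd _ _ _ ∘ₗ LinearMap.fst _ _ _) +
      (LinearMap.toSpanSingleton _ _ z).comp (LinearMap.snd _ _ _)))
    (fun z => by simp) (fun w => by
      simpa using J.add_mem (J.smul_mem _ hy) (J.smul_mem _ hz)) ((x, a), b)
  simpa using this

end IsConjugateModulo

theorem isUnimodular_iff {x : P} {a b : MonoidAlgebra ℤ G} :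
    IsUnimodular (R := MonoidAlgebra ℤ G) ((x, a), b) ↔
      ∃ (h : P →ₗ[MonoidAlgebra ℤ G] MonoidAlgebra ℤ G) (s t : MonoidAlgebra ℤ G),
        h x + a * s + b * t = 1 := by
  constructor
  · rintro ⟨H, hH⟩
    refine ⟨H ∘ₗ LinearMap.inl _ _ _ ∘ₗ LinearMap.inl _ _ _, H ((0, 1), 0), H ((0, 0), 1), ?_⟩
    refine Eq.trans ?_ hH
    rw [← smul_eq_mul, ← smul_eq_mul, ← map_smul, ← map_smul]
    simp [← map_add]
  · rintro ⟨h, s, t, hH⟩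
    refine ⟨h ∘ₗ LinearMap.fst _ _ _ ∘ₗ LinearMap.fst _ _ _ +
      LinearMap.toSpanSingleton _ _ s ∘ₗ LinearMap.snd _ _ _ ∘ₗ LinearMap.fst _ _ _ +
      LinearMap.toSpanSingleton _ _ t ∘ₗ LinearMap.snd _ _ _, ?_⟩
    simpa using hH

variable (J : Submodule (MonoidAlgebra ℤ G) P)

/-- This is the Euclidean algorithm on the augmentations of the two free coordinates. -/
theorem exists_isConjugateModulo_aug_eq_zero (x : P) (a b : MonoidAlgebra ℤ G) :
    ∃ a' b', IsConjugateModulo J ((x, a), b) ((x, a'), b') ∧ groupRingAug G b' = 0 := by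
  induction hk : (groupRingAug G b).natAbs using Nat.strong_induction_on generalizing a b with
  | _ k ih =>
    by_cases hb : groupRingAug G b = 0
    · exact ⟨a, b, .refl _, hb⟩
    · let q : ℤ := groupRingAug G a / groupRingAug G b
      have h1 : groupRingAug G (a + ((0 : P →ₗ[MonoidAlgebra ℤ G] MonoidAlgebra ℤ G) x +
          b * (-q : ℤ))) = groupRingAug G a % groupRingAug G b := by
        rw [Int.emod_def]
        simp [q, sub_eq_add_neg]
      obtain ⟨a', b', hr, hb'⟩ := ih _ (by
        rw [h1, ← hk]
        have h2 := Int.emod_nonneg (groupRingAug G a) hb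
        have h3 := Int.emod_lt_abs (groupRingAug G a) hb
        rw [Int.abs_eq_natAbs] at h3
        omega) b (a + ((0 : P →ₗ[MonoidAlgebra ℤ G] MonoidAlgebra ℤ G) x + b * (-q : ℤ))) rfl
      exact ⟨a', b', (IsConjugateModulo.add_left 0 _ x a b).trans
        ((IsConjugateModulo.swap _ _ _).trans hr), hb'⟩

/-- Once b has augmentation 0, applying the augmentation to the unimodularity relation shows that h
x + a s has augmentation 1; added to b, it serves to clear the other coordinate. -/
theorem exists_isConjugateModulo_aug_eq {x : P} {a b : MonoidAlgebra ℤ G}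
    (hv : IsUnimodular (R := MonoidAlgebra ℤ G) ((x, a), b)) :
    ∃ a' b', IsConjugateModulo J ((x, a), b) ((x, a'), b') ∧ groupRingAug G a' = 1 ∧
      groupRingAug G b' = 0 := by
  obtain ⟨a₁, b₁, h1, hb₁⟩ := exists_isConjugateModulo_aug_eq_zero J x a b
  obtain ⟨h, s, t, hst⟩ := isUnimodular_iff.1 (h1.isUnimodular hv)
  have h2 := h1.trans (IsConjugateModulo.add_right h s x a₁ b₁)
  set b₂ := b₁ + (h x + a₁ * s)
  have hb₂ : groupRingAug G b₂ = 1 := by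
    have := congrArg (groupRingAug G) hst
    simp only [map_add, map_mul, hb₁, map_one, zero_mul, add_zero] at this
    simp only [b₂, map_add, map_mul, hb₁, zero_add, this]
  refine ⟨b₂, _, (h2.trans (IsConjugateModulo.add_left 0 (-(groupRingAug G a₁) : ℤ) x a₁ b₂)).trans
    (IsConjugateModulo.swap _ _ _), hb₂, ?_⟩
  simp [hb₂]

theorem exists_isConjugateModulo_isUnit_red [Finite G] (m : ℕ) [NeZero m] {x : P}
    {a b : MonoidAlgebra ℤ G} (hv : IsUnimodular (R := MonoidAlgebra ℤ G) ((x, a), b))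
    (ha : groupRingAug G a = 1) :
    ∃ a', IsConjugateModulo J ((x, a), b) ((x, a'), b) ∧ groupRingAug G a' = 1 ∧
      IsUnit (groupRingRed G m a') := by
  obtain ⟨h, s, t, hst⟩ := isUnimodular_iff.1 hv
  have hfin := finite_groupRing_zmod (G := G) (m := m)
  -- The factor 1 - a has augmentation 0, so the correction to a provided by stable range one leaves
  -- its augmentation equal to 1.
  have h1 : a * (1 + s * (1 - a)) + (h x * (1 - a) + b * (t * (1 - a))) * 1 = 1 := by
    calc _ = a + (h x + a * s + b * t) * (1 - a) := by noncomm_ring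
      _ = 1 := by rw [hst]; noncomm_ring
  obtain ⟨c, hc⟩ := exists_isUnit_add_mul_of_finite' (groupRingRed G m a) (groupRingRed G m
    (h x * (1 - a) + b * (t * (1 - a)))) (groupRingRed G m (1 + s * (1 - a))) 1
    (by rw [← map_one (groupRingRed G m), ← map_mul, ← map_mul, ← map_add, h1])
  obtain ⟨c, rfl⟩ := groupRingRed_surjective c
  refine ⟨_, IsConjugateModulo.add_left (LinearMap.toSpanSingleton _ _ ((1 - a) * c) ∘ₗ h)
    (t * ((1 - a) * c)) x a b, ?_, ?_⟩
  · simp [ha]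
  · convert hc using 1
    rw [← map_mul, ← map_add]
    congr 1
    simp only [LinearMap.comp_apply, LinearMap.toSpanSingleton_apply, smul_eq_mul]
    noncomm_ring

/-- The right ideal of a contains an integer k prime to 2d|G|, so it suffices to solve the equation
modulo k. There N / |G| is a central idempotent e: on its component a acts as 1, and on the
complementary one a multiple of g takes the value 1 at w, so that w behaves as a free coordinate. -/
theorem exists_unimodular_add_smul [Finite G] {w : P} (hw : w ∈ J)
    (g : P →ₗ[MonoidAlgebra ℤ G] MonoidAlgebra ℤ G) {d : ℕ}
    (hgw : g w = d • ((Nat.card G : MonoidAlgebra ℤ G) - groupRingNorm G))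
    {x : P} {a b : MonoidAlgebra ℤ G} (hv : IsUnimodular (R := MonoidAlgebra ℤ G) ((x, a), b))
    (ha : groupRingAug G a = 1) (hu : IsUnit (groupRingRed G (2 * d * Nat.card G) a)) :
    ∃ y ∈ J, ∃ (h : P →ₗ[MonoidAlgebra ℤ G] MonoidAlgebra ℤ G) (s : MonoidAlgebra ℤ G),
      h (x + b • y) + a * s = 1 := by
  obtain ⟨l, c₀, hc₀⟩ := exists_mul_eq_of_isUnit_red hu
  obtain ⟨h, s, t, hst⟩ := isUnimodular_iff.1 hv
  set k : ℤ := 1 + (2 * d * Nat.card G : ℕ) * l with hk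
  -- The factor 2 in the modulus makes k odd.
  have hk0 : k ≠ 0 := by
    intro h0
    have h1 : (2 : ℤ) * (d * Nat.card G * l) = -1 := by
      rw [h0] at hk
      push_cast at hk
      linarith
    omega
  have : NeZero k.natAbs := ⟨Int.natAbs_ne_zero.2 hk0⟩
  have hfin := finite_groupRing_zmod (G := G) (m := k.natAbs)
  set φ := groupRingRed G k.natAbs with hφ
  have hφk : φ (k : MonoidAlgebra ℤ G) = 0 := by
    rw [map_intCast, MonoidAlgebra.intCast_def, (ZMod.intCast_zmod_eq_zero_iff_dvd _ _).2
      (Int.natAbs_dvd.2 dvd_rfl), MonoidAlgebra.single_zero]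
  let γ : ℤ := -2 * l * d
  let e : MonoidAlgebra ℤ G := γ • groupRingNorm G
  have hγ : φ (γ * Nat.card G : ℤ) = 1 := by
    have : (γ * Nat.card G : ℤ) = 1 - k := by rw [hk]; push_cast; ring
    rw [this, Int.cast_sub, map_sub, hφk, Int.cast_one, map_one, sub_zero]
  have hecomm : ∀ y, φ e * φ y = φ y * φ e := by
    intro y
    rw [← map_mul, ← map_mul, smul_mul_assoc, mul_smul_comm, groupRingNorm_mul, mul_groupRingNorm]
  have hee : φ e * φ e = φ e := by
    have : e * e = ((γ * Nat.card G : ℤ) : MonoidAlgebra ℤ G) * e := by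
      simp only [e, smul_mul_assoc, mul_smul_comm, groupRingNorm_mul, groupRingAug_norm]
      simp [mul_assoc]
    rw [← map_mul, this, map_mul, hγ, one_mul]
  have hae : φ a * φ e = φ e := by
    rw [← map_mul, mul_smul_comm, mul_groupRingNorm, ha, one_smul]
  let g' : P →ₗ[MonoidAlgebra ℤ G] MonoidAlgebra ℤ G := (-2 * l) • g
  have hg'w : φ (g' w) = 1 - φ e := by
    have : g' w = ((γ * Nat.card G : ℤ) : MonoidAlgebra ℤ G) - e := by
      simp only [g', e, γ, LinearMap.smul_apply, hgw]
      simp only [smul_sub, Int.cast_mul, Int.cast_neg, Int.cast_ofNat, Int.cast_natCast,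
        nsmul_eq_mul, zsmul_eq_mul]
      noncomm_ring
    rw [this, map_sub, hγ]
  -- With g' x · h w as the first term, the second element is what completes h x + a s + b t = 1;
  -- this makes the pair unimodular modulo k.
  obtain ⟨c, v, hc⟩ := exists_isUnit_add_mul_of_finite' (φ (g' x))
    (φ (h x - g' x * h w + a * s + b * t)) (φ (h w)) 1 (by
      rw [← map_one φ, ← map_mul, ← map_mul, ← map_add, mul_one]
      refine congrArg φ (Eq.trans ?_ hst)
      noncomm_ring)
  obtain ⟨c, rfl⟩ := groupRingRed_surjective c
  obtain ⟨q, hq⟩ := groupRingRed_surjective ((1 - φ e) * (↑v⁻¹ : MonoidAlgebra (ZMod k.natAbs) G))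
  change φ q = _ at hq
  change (v : MonoidAlgebra (ZMod k.natAbs) G) = φ (g' x) + _ * φ c at hc
  let y : P := (t * c) • w
  -- Modulo k and on the component of 1 - e, the c-term of h' vanishes at w, so h' w = 1. With y =
  -- tcw, the sum h'(x + by) + asc there becomes the unit v.
  let h' : P →ₗ[MonoidAlgebra ℤ G] MonoidAlgebra ℤ G := g' + LinearMap.toSpanSingleton _ _ c ∘ₗ
    (h - LinearMap.toSpanSingleton _ _ (h w) ∘ₗ g')
  have hh' : ∀ p, h' p = g' p + (h p - g' p * h w) * c := fun p => rfl
  have key : φ (h' (x + b • y) * q + a * (s * c * q + e)) = 1 := by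
    have h1 : φ (h' w) = 1 - φ e + φ e * φ (h w) * φ c := by
      rw [hh', map_add, map_mul, map_sub, map_mul, hg'w]
      noncomm_ring
    have h2 : φ (h' (x + b • y)) + φ (a * s * c) =
        v + φ (b * t * c) * (φ e * (φ (h w * c) - 1)) := by
      rw [map_add, map_smul, map_smul, smul_eq_mul, smul_eq_mul, map_add, map_mul, map_mul φ (t * c),
        h1, hc, hh']
      simp only [map_add, map_mul, map_sub]
      noncomm_ring
    have h3 : ∀ z, (φ e * (φ z - 1)) * (1 - φ e) = 0 := by
      intro z
      rw [← map_one φ, ← map_sub, hecomm, mul_assoc, map_one, mul_sub, mul_one, hee, sub_self,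
        mul_zero]
    have h4 : (φ (h' (x + b • y)) + φ (a * s * c)) * (1 - φ e) = v * (1 - φ e) := by
      rw [h2, add_mul, mul_assoc (φ (b * t * c)), h3, mul_zero, add_zero]
    have h5 : (v : MonoidAlgebra (ZMod k.natAbs) G) * (1 - φ e) = (1 - φ e) * v := by
      obtain ⟨v', hv'⟩ := groupRingRed_surjective (v : MonoidAlgebra (ZMod k.natAbs) G)
      rw [← hv', mul_sub, sub_mul, hecomm, mul_one, one_mul]
    calc φ (h' (x + b • y) * q + a * (s * c * q + e))
        = (φ (h' (x + b • y)) + φ (a * s * c)) * φ q + φ a * φ e := by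
          simp only [map_add, map_mul]
          noncomm_ring
      _ = 1 := by
          rw [hq, ← mul_assoc, h4, h5, mul_assoc, Units.mul_inv, hae, mul_one, sub_add_cancel]
  rw [← sub_eq_zero, ← map_one φ, ← map_sub] at key
  obtain ⟨z, hz⟩ := groupRingRed_eq_zero key
  -- The remaining error is |k| z, which lies in aℤG because a c₀ = k; the sign converts k to |k|.
  refine ⟨y, J.smul_mem _ hw, LinearMap.toSpanSingleton _ _ q ∘ₗ h',
    s * c * q + e - c₀ * ((k.sign : ℤ) * z), ?_⟩
  have h6 : a * (c₀ * ((k.sign : ℤ) * z)) = (k.natAbs : ℤ) • z := by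
    rw [← mul_assoc, hc₀, ← mul_assoc, ← Int.cast_mul, Int.mul_sign_self]
    simp
  change h' (x + b • y) * q + _ = 1
  rw [mul_sub, h6, ← hz]
  abel

/-- Transvections act transitively on the unimodular elements of `J ⊕ ℤG ⊕ ℤG`, provided `J` is
large enough. -/
theorem isConjugateModulo_of_isUnimodular [Finite G] {w : P} (hw : w ∈ J)
    (g : P →ₗ[MonoidAlgebra ℤ G] MonoidAlgebra ℤ G) {d : ℕ} (hd : 0 < d)
    (hgw : g w = d • ((Nat.card G : MonoidAlgebra ℤ G) - groupRingNorm G))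
    {x : P} (hx : x ∈ J) {a b : MonoidAlgebra ℤ G}
    (hv : IsUnimodular (R := MonoidAlgebra ℤ G) ((x, a), b)) :
    IsConjugateModulo J ((x, a), b) ((0, 0), 1) := by
  have : NeZero (2 * d * Nat.card G) :=
    ⟨by have := Nat.card_pos (α := G); positivity⟩
  obtain ⟨a₁, b₁, h1, ha₁, -⟩ := exists_isConjugateModulo_aug_eq J hv
  obtain ⟨a₂, h2, ha₂, hu⟩ := exists_isConjugateModulo_isUnit_red J (2 * d * Nat.card G)
    (h1.isUnimodular hv) ha₁
  have h12 := h1.trans h2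
  obtain ⟨y, hy, h, s, hs⟩ :=
    exists_unimodular_add_smul J hw g hgw (h12.isUnimodular hv) ha₂ hu
  have h3 := h12.trans (IsConjugateModulo.add_fst J.zero_mem hy x a₂ b₁)
  rw [smul_zero, zero_add] at h3
  -- The coordinates other than b₁ are now unimodular by themselves, so b₁ can be changed to 1. That
  -- 1 then clears the J-coordinate and a₂.
  have h4 := h3.trans (IsConjugateModulo.add_right
    (LinearMap.toSpanSingleton _ _ (1 - b₁) ∘ₗ h) (s * (1 - b₁)) _ _ _)
  have h5 : b₁ + ((LinearMap.toSpanSingleton _ _ (1 - b₁) ∘ₗ h) (x + b₁ • y) +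
      a₂ * (s * (1 - b₁))) = 1 := by
    change b₁ + (h (x + b₁ • y) * (1 - b₁) + a₂ * (s * (1 - b₁))) = 1
    rw [← mul_assoc, ← add_mul, hs]
    noncomm_ring
  rw [h5] at h4
  have h6 := h4.trans (IsConjugateModulo.add_fst J.zero_mem (J.neg_mem (h3.mem hx)) _ _ _)
  rw [smul_zero, one_smul, zero_add, add_neg_cancel] at h6
  have h7 := h6.trans (IsConjugateModulo.add_left 0 (-a₂) _ _ _)
  simpa using h7

end unimodular

/-! ### Characters of the cycles of a projective complex -/

section lattice

variable {G : Type*} [Group G]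

theorem finite_int_of_groupRing [Finite G] (M : Type*) [AddCommGroup M] [Module (MonoidAlgebra ℤ G) M]
    [Module.Finite (MonoidAlgebra ℤ G) M] : Module.Finite ℤ M :=
  Module.Finite.trans (MonoidAlgebra ℤ G) M

theorem free_int_of_groupRing_projective [Finite G] (P : Type*) [AddCommGroup P]
    [Module (MonoidAlgebra ℤ G) P] [Module.Finite (MonoidAlgebra ℤ G) P]
    [Module.Projective (MonoidAlgebra ℤ G) P] : Module.Free ℤ P := by
  have := finite_int_of_groupRing (G := G) P
  obtain ⟨N, q, i, -, hi, -⟩ :=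
    Module.Finite.exists_comp_eq_id_of_projective (MonoidAlgebra ℤ G) P
  have : Module.IsTorsionFree ℤ P :=
    Function.Injective.moduleIsTorsionFree i hi fun k x => map_zsmul i k x
  infer_instance

theorem groupRingTrace_eq_add_of_exact {K M L : Type*} [AddCommGroup K] [AddCommGroup M]
    [AddCommGroup L] [Module (MonoidAlgebra ℤ G) K] [Module (MonoidAlgebra ℤ G) M]
    [Module (MonoidAlgebra ℤ G) L] [Module.Finite ℤ K] [Module.Free ℤ K] [Module.Finite ℤ M]
    [Module.Free ℤ M] [Module.Finite ℤ L] [Module.Free ℤ L] (ι : K →ₗ[MonoidAlgebra ℤ G] M)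
    (f : M →ₗ[MonoidAlgebra ℤ G] L) (hι : Function.Injective ι) (hex : Function.Exact ι f)
    (hf : Function.Surjective f) (x : MonoidAlgebra ℤ G) :
    groupRingTrace G M x = groupRingTrace G K x + groupRingTrace G L x :=
  LinearMap.trace_eq_add_of_exact (ι.restrictScalars ℤ) (f.restrictScalars ℤ) hι hex hf _ _ _
    (fun y => map_smul ι x y) (fun y => map_smul f x y)

instance finite_int_submodule (M : Type*) [AddCommGroup M] [Module (MonoidAlgebra ℤ G) M]
    [Module.Finite ℤ M] (S : Submodule (MonoidAlgebra ℤ G) M) : Module.Finite ℤ S :=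
  inferInstanceAs (Module.Finite ℤ (S.restrictScalars ℤ))

instance free_int_submodule (M : Type*) [AddCommGroup M] [Module (MonoidAlgebra ℤ G) M]
    [Module.Finite ℤ M] [Module.Free ℤ M] (S : Submodule (MonoidAlgebra ℤ G) M) :
    Module.Free ℤ S :=
  inferInstanceAs (Module.Free ℤ (S.restrictScalars ℤ))

/-- The additive group underlying the trivial module. -/
def trivialZEquiv (G : Type*) [Group G] : TrivialZ G ≃ₗ[ℤ] ℤ :=
  (AddEquiv.refl ℤ : TrivialZ G ≃+ ℤ).toIntLinearEquiv

instance (G : Type*) [Group G] : Module.Finite ℤ (TrivialZ G) :=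
  Module.Finite.equiv (trivialZEquiv G).symm

instance (G : Type*) [Group G] : Module.Free ℤ (TrivialZ G) :=
  Module.Free.of_equiv (trivialZEquiv G).symm

theorem groupRingTrace_trivialZ (g : G) :
    groupRingTrace G (TrivialZ G) (MonoidAlgebra.single g 1) = 1 := by
  have : (Module.toModuleEnd ℤ (TrivialZ G) (MonoidAlgebra.single g (1 : ℤ)) :
      Module.End ℤ (TrivialZ G)) = LinearMap.id := by
    refine LinearMap.ext fun x => ?_
    change MonoidAlgebra.single g (1 : ℤ) • x = x
    rw [Representation.single_smul]
    simp only [Representation.trivial_apply, one_smul]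
    rfl
  rw [groupRingTrace_apply, this, LinearMap.trace_id, (trivialZEquiv G).finrank_eq]
  simp

end lattice

namespace ProjectiveComplex

variable {G : Type u} [Group G] {n : ℕ}

/-- The cycles of the augmented complex. -/
noncomputable def cycles (E : ProjectiveComplex G n) :
    ∀ i, Submodule (MonoidAlgebra ℤ G) (E.cx.X i)
  | 0 => LinearMap.ker E.aug
  | i + 1 => LinearMap.ker (E.cx.d (i + 1) i).hom

theorem aug_d (E : ProjectiveComplex G n) (y : E.cx.X 1) : E.aug ((E.cx.d 1 0).hom y) = 0 := by
  rcases Nat.eq_zero_or_pos n with rfl | hn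
  · have := ModuleCat.subsingleton_of_isZero (E.isZero_of_lt 1 Nat.one_pos)
    rw [Subsingleton.elim y 0, map_zero, map_zero]
  · exact (E.exact_aug hn).apply_apply_eq_zero y

theorem d_apply_of_mem_cycles {E : ProjectiveComplex G n} {i : ℕ} {x : E.cx.X i}
    (hx : x ∈ E.cycles i) (j : ℕ) : (E.cx.d i j).hom x = 0 := by
  by_cases hij : (ComplexShape.down ℕ).Rel i j
  · obtain rfl : j + 1 = i := hij
    exact hx
  · rw [E.cx.shape i j hij]
    rfl

/-- Traces add along 0 → cycles i+1 → Pᵢ₊₁ → cycles i → 0 and projectives contribute 0, so the sign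
alternates, starting from the trivial module with character 1. -/
theorem groupRingTrace_cycles [Finite G] (E : ProjectiveComplex G n) {g : G} (hg : g ≠ 1) {i : ℕ}
    (hi : i ≤ n) :
    groupRingTrace G (E.cycles i) (MonoidAlgebra.single g 1) = (-1) ^ (i + 1) := by
  have hfin : ∀ j, Module.Finite ℤ (E.cx.X j) := fun j =>
    have := E.finite j
    finite_int_of_groupRing (G := G) _
  have hfree : ∀ j, Module.Free ℤ (E.cx.X j) := fun j =>
    have := E.finite j
    have := E.projective j
    free_int_of_groupRing_projective (G := G) _
  have hX : ∀ j, groupRingTrace G (E.cx.X j) (MonoidAlgebra.single g 1) = 0 := fun j =>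
    have := E.finite j
    have := E.projective j
    groupRingTrace_eq_zero_of_projective g hg
  induction i with
  | zero =>
    have h := groupRingTrace_eq_add_of_exact (E.cycles 0).subtype E.aug
      Subtype.val_injective
      (fun x => ⟨fun h => ⟨⟨x, h⟩, rfl⟩, by rintro ⟨y, rfl⟩; exact y.2⟩) E.aug_surjective (MonoidAlgebra.single g 1)
    rw [hX, groupRingTrace_trivialZ] at h
    rw [zero_add, pow_one]
    linarith
  | succ i ih =>
    have hmem : ∀ x, (E.cx.d (i + 1) i).hom x ∈ E.cycles i := by
      intro x
      cases i with
      | zero => exact E.aug_d x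
      | succ i =>
        exact congrArg (fun f => f.hom x) (E.cx.d_comp_d (i + 2) (i + 1) i)
    have hsurj : Function.Surjective (LinearMap.codRestrict (E.cycles i) _ hmem) := by
      rintro ⟨y, hy⟩
      have : ∃ x, (E.cx.d (i + 1) i).hom x = y := by
        cases i with
        | zero => exact (E.exact_aug hi y).1 hy
        | succ i => exact (E.exact_d i hi y).1 hy
      obtain ⟨x, hx⟩ := this
      exact ⟨x, Subtype.ext hx⟩
    have h := groupRingTrace_eq_add_of_exact (E.cycles (i + 1)).subtype
      (LinearMap.codRestrict (E.cycles i) _ hmem) Subtype.val_injective (fun x =>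
        ⟨fun h => ⟨⟨x, congrArg Subtype.val h⟩, rfl⟩, by
          rintro ⟨y, rfl⟩
          exact Subtype.ext y.2⟩) hsurj (MonoidAlgebra.single g 1)
    rw [hX, ih (Nat.le_of_succ_le hi)] at h
    rw [pow_succ]
    linarith

/-- If `n` is even, the top cycles contain, up to isogeny, the complement of the trivial module in
the group ring as a direct summand. -/
theorem exists_linearMap_apply_cycles [Finite G] (hn : Even n) (E : ProjectiveComplex G n) :
    ∃ w ∈ E.cycles n, ∃ (g : E.cx.X n →ₗ[MonoidAlgebra ℤ G] MonoidAlgebra ℤ G) (d : ℕ),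
      0 < d ∧ g w = d • ((Nat.card G : MonoidAlgebra ℤ G) - groupRingNorm G) := by
  have := E.finite n
  have := E.projective n
  have := finite_int_of_groupRing (G := G) (E.cx.X n)
  have := free_int_of_groupRing_projective (G := G) (E.cx.X n)
  obtain ⟨w, q, d, hd, hq⟩ := exists_apply_eq_smul_card_sub_norm (G := G) (W := E.cycles n)
    fun g hg => by rw [E.groupRingTrace_cycles hg le_rfl, hn.add_one.neg_one_pow]
  obtain ⟨D, hD, π, hπ⟩ := (E.cycles n).exists_equivariant_smul
  refine ⟨w, w.2, q ∘ₗ π, (D * d).toNat, by have := mul_pos hD hd; omega, ?_⟩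
  rw [LinearMap.comp_apply, hπ, map_zsmul, hq, ← mul_smul, ← natCast_zsmul,
    Int.toNat_of_nonneg (mul_pos hD hd).le]

section homotopy

theorem aug_eq_of_homotopy {E : ProjectiveComplex G n} {K : ChainComplex (ModuleCat _) ℕ}
    {f g : K ⟶ E.cx} (h : Homotopy f g) (x : K.X 0) :
    E.aug ((f.f 0).hom x) = E.aug ((g.f 0).hom x) := by
  have h1 := h.comm 0
  rw [Homotopy.dNext_zero_chainComplex, Homotopy.prevD_chainComplex, zero_add] at h1
  rw [h1]
  change E.aug (((E.cx.d 1 0).hom ((h.hom 0 1).hom x)) + (g.f 0).hom x) = _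
  rw [map_add, aug_d, zero_add]

/-- In top degree a homotopy contributes only through the differential of the source, which vanishes
on cycles. -/
theorem apply_eq_of_homotopy {E : ProjectiveComplex G n} {K : ChainComplex (ModuleCat _) ℕ}
    {f g : K ⟶ E.cx} (h : Homotopy f g) (x : K.X n) (hx : ∀ j, (K.d n j).hom x = 0) :
    (f.f n).hom x = (g.f n).hom x := by
  have h1 := h.comm n
  rw [Homotopy.prevD_chainComplex, (E.isZero_of_lt (n + 1) n.lt_succ_self).eq_of_tgt
    (h.hom n (n + 1)) 0, zero_comp, add_zero] at h1
  rw [h1]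
  change (h.hom _ _).hom ((K.d n _).hom x) + (g.f n).hom x = _
  rw [hx, map_zero, zero_add]

theorem Equivalent.symm {E E' : ProjectiveComplex G n} (h : E.Equivalent E') :
    E'.Equivalent E := by
  obtain ⟨φ, θ, hθ⟩ := h
  refine ⟨φ.symm, θ.symm, fun x => ?_⟩
  rw [LinearEquiv.eq_symm_apply, ← hθ]
  exact aug_eq_of_homotopy φ.homotopyInvHomId x

theorem Equivalent.trans {E E' E'' : ProjectiveComplex G n} (h : E.Equivalent E')
    (h' : E'.Equivalent E'') : E.Equivalent E'' := by
  obtain ⟨φ, θ, hθ⟩ := h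
  obtain ⟨φ', θ', hθ'⟩ := h'
  refine ⟨φ.trans φ', θ.trans θ', fun x => ?_⟩
  exact (hθ' _).trans (congrArg θ' (hθ x))

end homotopy

end ProjectiveComplex

/-! ### Homotopy equivalences and direct summands -/

section additive

variable {V : Type*} [Category V] [Preadditive V] [HasFiniteBiproducts V] {ι : Type*}
  {c : ComplexShape ι} {C D L : HomologicalComplex V c}

/-- The sum of a homotopy equivalence and an identity. -/
noncomputable def HomotopyEquiv.biprodMap (φ : HomotopyEquiv C D) (L : HomologicalComplex V c)
    [HasBinaryBiproduct C L] [HasBinaryBiproduct D L] :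
    HomotopyEquiv (C ⊞ L) (D ⊞ L) where
  hom := biprod.map φ.hom (𝟙 L)
  inv := biprod.map φ.inv (𝟙 L)
  homotopyHomInvId :=
    ((Homotopy.ofEq (by
      apply biprod.hom_ext' <;> apply biprod.hom_ext <;> simp)).trans
      (((φ.homotopyHomInvId.compRight biprod.inl).compLeft biprod.fst).add
        (Homotopy.refl (biprod.snd ≫ biprod.inr)))).trans (Homotopy.ofEq (by ext; simp))
  homotopyInvHomId :=
    ((Homotopy.ofEq (by
      apply biprod.hom_ext' <;> apply biprod.hom_ext <;> simp)).trans
      (((φ.homotopyInvHomId.compRight biprod.inl).compLeft biprod.fst).add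
        (Homotopy.refl (biprod.snd ≫ biprod.inr)))).trans (Homotopy.ofEq (by ext; simp))

/-- Cancellation of a summand preserved by a homotopy equivalence. -/
noncomputable def HomotopyEquiv.cancelRight [HasBinaryBiproduct C L] [HasBinaryBiproduct D L]
    (φ : HomotopyEquiv (C ⊞ L) (D ⊞ L)) (hφ : biprod.inr ≫ φ.hom = biprod.inr) :
    HomotopyEquiv C D where
  hom := biprod.inl ≫ φ.hom ≫ biprod.fst
  inv := biprod.inl ≫ φ.inv ≫ biprod.fst
  homotopyHomInvId := by
    have h1 : Homotopy (biprod.inr ≫ φ.inv) (biprod.inr : L ⟶ C ⊞ L) :=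
      (Homotopy.ofEq (by rw [← hφ, Category.assoc])).trans
        (φ.homotopyHomInvId.compLeftId biprod.inr)
    -- Inserting fst ≫ inl = 1 - snd ≫ inr leaves a term through inr ≫ inv ≫ fst, which is
    -- null-homotopic by `h1`.
    have h2 := (((φ.homotopyHomInvId.compRight biprod.fst).compLeft biprod.inl).add
      ((h1.compRight biprod.fst).compLeft (-(biprod.inl ≫ φ.hom ≫ biprod.snd))))
    refine ((Homotopy.ofEq ?_).trans h2).trans (Homotopy.ofEq (by simp))
    have h3 : (biprod.fst : D ⊞ L ⟶ D) ≫ biprod.inl = 𝟙 _ - biprod.snd ≫ biprod.inr := by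
      rw [← biprod.total, add_sub_cancel_right]
    calc _ = biprod.inl ≫ φ.hom ≫ (biprod.fst ≫ biprod.inl) ≫ φ.inv ≫ biprod.fst := by simp
      _ = _ := by rw [h3]; simp [sub_eq_add_neg]
  homotopyInvHomId := by
    refine ((Homotopy.ofEq ?_).trans
      ((φ.homotopyInvHomId.compRight biprod.fst).compLeft biprod.inl)).trans
      (Homotopy.ofEq (by simp))
    have h3 : (biprod.fst : C ⊞ L ⟶ C) ≫ biprod.inl = 𝟙 _ - biprod.snd ≫ biprod.inr := by
      rw [← biprod.total, add_sub_cancel_right]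
    calc _ = biprod.inl ≫ φ.inv ≫ (biprod.fst ≫ biprod.inl) ≫ φ.hom ≫ biprod.fst := by simp
      _ = _ := by rw [h3]; simp [reassoc_of% hφ]

end additive

/-! ### Automorphisms concentrated in the top degree -/

section topDegree

variable {V : Type*} [Category V] [HasZeroMorphisms V]

/-- The endomorphism of a chain complex concentrated in degrees at most `n` which is given by `α`
in degree `n` and the identity elsewhere. -/
noncomputable def ChainComplex.endOfTop (K : ChainComplex V ℕ) (n : ℕ)
    (hK : ∀ i, n < i → IsZero (K.X i)) (α : K.X n ⟶ K.X n) (hα : ∀ j, α ≫ K.d n j = K.d n j) :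
    K ⟶ K where
  f := Function.update (fun i => 𝟙 (K.X i)) n α
  comm' i j hij := by
    obtain rfl : j + 1 = i := hij
    by_cases hj : j = n
    · subst hj
      exact (hK _ (Nat.lt_succ_self _)).eq_of_src _ _
    · rw [Function.update_of_ne hj]
      by_cases hi : j + 1 = n
      · subst hi
        simp [hα]
      · rw [Function.update_of_ne hi]
        simp

@[simp]
theorem ChainComplex.endOfTop_f_self (K : ChainComplex V ℕ) (n : ℕ)
    (hK : ∀ i, n < i → IsZero (K.X i)) (α : K.X n ⟶ K.X n) (hα : ∀ j, α ≫ K.d n j = K.d n j) :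
    (K.endOfTop n hK α hα).f n = α :=
  Function.update_self (β := fun i => K.X i ⟶ K.X i) n α fun i => 𝟙 (K.X i)

theorem ChainComplex.endOfTop_f_of_ne (K : ChainComplex V ℕ) (n : ℕ)
    (hK : ∀ i, n < i → IsZero (K.X i)) (α : K.X n ⟶ K.X n) (hα : ∀ j, α ≫ K.d n j = K.d n j)
    {i : ℕ} (hi : i ≠ n) : (K.endOfTop n hK α hα).f i = 𝟙 _ :=
  Function.update_of_ne (β := fun i => K.X i ⟶ K.X i) hi α fun i => 𝟙 (K.X i)

/-- The automorphism of a chain complex concentrated in degrees at most `n` which is given by `α`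
in degree `n` and the identity elsewhere. -/
noncomputable def ChainComplex.autOfTop (K : ChainComplex V ℕ) (n : ℕ)
    (hK : ∀ i, n < i → IsZero (K.X i)) (α : K.X n ≅ K.X n)
    (hα : ∀ j, α.hom ≫ K.d n j = K.d n j) : K ≅ K where
  hom := K.endOfTop n hK α.hom hα
  inv := K.endOfTop n hK α.inv fun j => by rw [Iso.inv_comp_eq, hα]
  hom_inv_id := by
    ext i
    by_cases hi : i = n
    · subst hi; simp
    · simp [endOfTop_f_of_ne _ _ _ _ _ hi]
  inv_hom_id := by
    ext i
    by_cases hi : i = n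
    · subst hi; simp
    · simp [endOfTop_f_of_ne _ _ _ _ _ hi]

end topDegree

/-! ### Cancellation of a stabilisation -/

namespace ProjectiveComplex

variable {G : Type u} [Group G] {n : ℕ}

theorem Equivalent.stabilize {E E' : ProjectiveComplex G n} (h : E.Equivalent E') :
    E.stabilize.Equivalent E'.stabilize := by
  obtain ⟨φ, θ, hθ⟩ := h
  refine ⟨φ.biprodMap _, θ, fun x => ?_⟩
  have h1 := congrArg (fun f => (f.f 0).hom x)
    (biprod.map_fst φ.hom (𝟙 (groupRingInDegree G n)))
  exact (congrArg E'.aug h1).trans (hθ _)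

/-- The degree `n` part of `ℤG` in degree `n`. -/
noncomputable def groupRingInDegreeEquiv (G : Type u) [Group G] (n : ℕ) :
    (groupRingInDegree G n).X n ≃ₗ[MonoidAlgebra ℤ G] MonoidAlgebra ℤ G :=
  (HomologicalComplex.singleObjXSelf (ComplexShape.down ℕ) n
    (ModuleCat.of (MonoidAlgebra ℤ G) (MonoidAlgebra ℤ G))).toLinearEquiv

/-- The degree `n` part of a stabilisation. -/
noncomputable def stabilizeEquiv (E : ProjectiveComplex G n) :
    E.stabilize.cx.X n ≃ₗ[MonoidAlgebra ℤ G] E.cx.X n × MonoidAlgebra ℤ G :=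
  (biprodXEquiv E.cx (groupRingInDegree G n) n).trans
    ((LinearEquiv.refl _ _).prodCongr (groupRingInDegreeEquiv G n))

theorem biprod_groupRingInDegree_d_eq_zero_iff
    (C : ChainComplex (ModuleCat.{u} (MonoidAlgebra ℤ G)) ℕ) (i j : ℕ)
    (z : (C ⊞ groupRingInDegree G n).X i) :
    ((C ⊞ groupRingInDegree G n).d i j).hom z = 0 ↔
      (C.d i j).hom (biprodXEquiv C (groupRingInDegree G n) i z).1 = 0 := by
  rw [← (biprodXEquiv C (groupRingInDegree G n) j).map_eq_zero_iff, biprodXEquiv_d,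
    Prod.mk_eq_zero]
  refine and_iff_left ?_
  rw [HomologicalComplex.single_obj_d]
  rfl

theorem mem_cycles_stabilize {E : ProjectiveComplex G n} {z : E.stabilize.cx.X n} :
    z ∈ E.stabilize.cycles n ↔ (E.stabilizeEquiv z).1 ∈ E.cycles n := by
  cases n with
  | zero => rfl
  | succ n =>
    exact biprod_groupRingInDegree_d_eq_zero_iff E.cx (n + 1) n z

theorem inr_eq_stabilizeEquiv_symm (E : ProjectiveComplex G n) (a : MonoidAlgebra ℤ G) :
    ((biprod.inr : groupRingInDegree G n ⟶ E.cx ⊞ groupRingInDegree G n).f n).hom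
      ((groupRingInDegreeEquiv G n).symm a) = E.stabilizeEquiv.symm (0, a) := by
  change _ = ((biprod.inl : E.cx ⟶ E.cx ⊞ groupRingInDegree G n).f n).hom 0 +
    ((biprod.inr : groupRingInDegree G n ⟶ E.cx ⊞ groupRingInDegree G n).f n).hom
      ((groupRingInDegreeEquiv G n).symm a)
  rw [map_zero, zero_add]

theorem map_mem_cycles {E E' : ProjectiveComplex G n} {f : E.cx ⟶ E'.cx}
    {θ : TrivialZ G ≃ₗ[MonoidAlgebra ℤ G] TrivialZ G}
    (hθ : ∀ x, E'.aug ((f.f 0).hom x) = θ (E.aug x)) {i : ℕ} {x : E.cx.X i}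
    (hx : x ∈ E.cycles i) : (f.f i).hom x ∈ E'.cycles i := by
  cases i with
  | zero =>
    change E'.aug _ = 0
    rw [hθ, show E.aug x = 0 from hx, map_zero]
  | succ i =>
    have h1 := congrArg (fun g => g.hom x) (f.comm (i + 1) i)
    refine h1.trans ?_
    change (f.f i).hom ((E.cx.d (i + 1) i).hom x) = 0
    rw [show (E.cx.d (i + 1) i).hom x = 0 from hx, map_zero]

/-- An automorphism of the top module which is the identity modulo cycles extends to a self
equivalence. -/
theorem exists_iso_of_sub_mem_cycles (F : ProjectiveComplex G n)
    (α : F.cx.X n ≃ₗ[MonoidAlgebra ℤ G] F.cx.X n) (hα : ∀ z, α z - z ∈ F.cycles n) :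
    ∃ A : F.cx ≅ F.cx, (∀ z, (A.hom.f n).hom z = α z) ∧
      ∀ x, F.aug ((A.hom.f 0).hom x) = F.aug x := by
  have hd : ∀ j, α.toModuleIso.hom ≫ F.cx.d n j = F.cx.d n j := by
    intro j
    ext z
    have h := d_apply_of_mem_cycles (hα z) j
    rw [map_sub, sub_eq_zero] at h
    exact h
  have hA : ∀ z, (((F.cx.autOfTop n F.isZero_of_lt α.toModuleIso hd).hom.f n).hom z) = α z := by
    intro z
    exact congrArg (fun f => f.hom z)
      (ChainComplex.endOfTop_f_self F.cx n F.isZero_of_lt α.toModuleIso.hom hd)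
  refine ⟨F.cx.autOfTop n F.isZero_of_lt α.toModuleIso hd, hA, fun x => ?_⟩
  cases n with
  | zero =>
    rw [hA]
    have h : F.aug (α x - x) = 0 := hα x
    rwa [map_sub, sub_eq_zero] at h
  | succ n =>
    have h := congrArg (fun f => f.hom x)
      (ChainComplex.endOfTop_f_of_ne F.cx (n + 1) F.isZero_of_lt α.toModuleIso.hom hd
        (Nat.succ_ne_zero n).symm)
    exact congrArg F.aug h

/-- If `E ⊕ ℤG ⊕ ℤG ≃ E' ⊕ ℤG`, then `E ⊕ ℤG ≃ E'`, in even dimension. -/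
theorem Equivalent.of_stabilize_stabilize [Finite G] (hn : Even n) {E E' : ProjectiveComplex G n}
    (h : E'.stabilize.Equivalent E.stabilize.stabilize) : E'.Equivalent E.stabilize := by
  obtain ⟨φ, θ, hθ⟩ := h
  let F := E.stabilize.stabilize
  let e : F.cx.X n ≃ₗ[MonoidAlgebra ℤ G]
      (E.cx.X n × MonoidAlgebra ℤ G) × MonoidAlgebra ℤ G :=
    E.stabilize.stabilizeEquiv.trans (E.stabilizeEquiv.prodCongr (LinearEquiv.refl _ _))
  have he : ∀ z, z ∈ F.cycles n ↔ (e z).1.1 ∈ E.cycles n := fun z =>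
    mem_cycles_stabilize.trans mem_cycles_stabilize
  let ι : E'.stabilize.cx.X n := E'.stabilizeEquiv.symm (0, 1)
  have hι : ι ∈ E'.stabilize.cycles n := by
    rw [mem_cycles_stabilize, LinearEquiv.apply_symm_apply]
    exact zero_mem _
  let v : F.cx.X n := (φ.hom.f n).hom ι
  have hv : v ∈ F.cycles n := map_mem_cycles hθ hι
  have hinv : (φ.inv.f n).hom v = ι :=
    apply_eq_of_homotopy (E := E'.stabilize) φ.homotopyHomInvId ι
      fun j => d_apply_of_mem_cycles hι j
  obtain ⟨w, hw, g, d, hd, hgw⟩ := E.exists_linearMap_apply_cycles hn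
  -- The homotopy inverse returns v exactly to the generator `ι`, so its last coordinate is a linear
  -- form with value 1 at v.
  have huni : IsUnimodular (R := MonoidAlgebra ℤ G) (e v) := by
    refine ⟨LinearMap.snd _ _ _ ∘ₗ E'.stabilizeEquiv.toLinearMap ∘ₗ (φ.inv.f n).hom ∘ₗ
      e.symm.toLinearMap, ?_⟩
    change (E'.stabilizeEquiv ((φ.inv.f n).hom (e.symm (e v)))).2 = 1
    rw [LinearEquiv.symm_apply_apply, hinv, LinearEquiv.apply_symm_apply]
  obtain ⟨β, hβ, hβv⟩ := isConjugateModulo_of_isUnimodular (E.cycles n) hw g hd hgw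
    ((he v).1 hv) huni
  obtain ⟨A, hA, hAaug⟩ := exists_iso_of_sub_mem_cycles F (e.trans (β.trans e.symm)) fun z => by
    rw [he, map_sub]
    change (e (e.symm (β (e z)))).1.1 - (e z).1.1 ∈ _
    rw [LinearEquiv.apply_symm_apply]
    exact hβ (e z)
  -- The cancellation needs strict equality on the summand ℤG; it is enough to check the generator 1
  -- in degree n.
  have key : biprod.inr ≫ (φ.trans (HomotopyEquiv.ofIso A)).hom =
      (biprod.inr : groupRingInDegree G n ⟶ E.stabilize.cx ⊞ groupRingInDegree G n) := by
    ext y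
    obtain ⟨a, rfl⟩ := (groupRingInDegreeEquiv G n).symm.surjective y
    have h1 : (groupRingInDegreeEquiv G n).symm a =
      a • (groupRingInDegreeEquiv G n).symm 1 := by
        rw [← map_smul, smul_eq_mul, mul_one]
    rw [h1, map_smul, map_smul]
    congr 1
    change (A.hom.f n).hom ((φ.hom.f n).hom ((biprod.inr :
      groupRingInDegree G n ⟶ E'.cx ⊞ groupRingInDegree G n).f n
        ((groupRingInDegreeEquiv G n).symm 1))) = _
    rw [inr_eq_stabilizeEquiv_symm]
    refine ((hA v).trans ?_).trans (inr_eq_stabilizeEquiv_symm E.stabilize 1).symm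
    have h2 : E.stabilizeEquiv 0 = ((0, 0) : E.cx.X n × MonoidAlgebra ℤ G) := map_zero _
    have h3 : e (E.stabilize.stabilizeEquiv.symm (0, 1)) = ((0, 0), 1) := by
      change (E.stabilizeEquiv ((E.stabilize.stabilizeEquiv
        (E.stabilize.stabilizeEquiv.symm (0, 1))).1), (E.stabilize.stabilizeEquiv
        (E.stabilize.stabilizeEquiv.symm (0, 1))).2) = _
      rw [LinearEquiv.apply_symm_apply, h2]
    exact (e.symm_apply_eq).2 (hβv.trans h3.symm)
  refine ⟨(φ.trans (HomotopyEquiv.ofIso A)).cancelRight key, θ, fun x => ?_⟩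
  let x' : E'.stabilize.cx.X 0 :=
    ((biprod.inl : E'.cx ⟶ E'.cx ⊞ groupRingInDegree G n).f 0).hom x
  have h1 : E'.stabilize.aug x' = E'.aug x :=
    congrArg E'.aug (congrArg (fun f => (f.f 0).hom x)
      (biprod.inl_fst (X := E'.cx) (Y := groupRingInDegree G n)))
  rw [← h1, ← hθ]
  exact hAaug _

end ProjectiveComplex

theorem mainTheorem4 {G : Type u} [Group G] [Finite G] {n : ℕ} (hn : Even n)
    (E E' E₀ : ProjectiveComplex G n)
    (h₀ : E.Equivalent E₀.stabilize)
    (h : E.stabilize.Equivalent E'.stabilize) :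
    E.Equivalent E' :=
  h₀.trans (ProjectiveComplex.Equivalent.of_stabilize_stabilize hn
    (h.symm.trans h₀.stabilize)).symm
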